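/- **Lemma 7.** Let $S\in\mathbb{Z}^{n\times n}$ be symmetric, positive definite and maximal even (i.e. $S[x]:=x^{tr}Sx$ is even for all $x\in\mathbb{Z}^n$, and no subgroup of $\mathbb{Q}^n$ properly containing $\mathbb{Z}^n$ has this property). Put $$S_0=\begin{pmatrix}0&0&1\\0&-S&0\\1&0&0\end{pmatrix},\qquad S_1=\begin{pmatrix}0&0&1\\0&S_0&0\\1&0&0\end{pmatrix},\qquad T[x]:=x^{tr}Tx .$$ Let $\mathcal{H}_S=\{w=(\tau,z,\tau')^{tr}\in\mathbb{C}^{n+2};\ S_0[\operatorname{Im}w]>0,\ \operatorname{Im}\tau>0,\ \operatorname{Im}\tau'>0\}$ and let $SO^+(S_1;\mathbb{R})$ be the group of all $M=\begin{pmatrix}\alpha&a^{tr}&\beta\\b&K&c\\\gamma&d^{tr}&\delta\end{pmatrix}\in\mathrm{SL}_{n+4}(\mathbb{R})$ with $M^{tr}S_1M=S_1$ that map $\mathcal{H}_S$ onto itself under $$w\mapsto\bigl(-\tfrac12S_0[w]\,b+Kw+c\bigr)\bigl(-\tfrac{\gamma}{2}S_0[w]+d^{tr}w+\delta\bigr)^{-1}.$$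 Let $\Gamma_S=\{M\in SO^+(S_1;\mathbb{R});\ M\in I+\mathbb{Z}^{(n+4)\times(n+4)}S_1\}$ be the discriminant kernel, and for a prime $q$ put $$\mathcal{T}_S(q)=\Gamma_S\operatorname{diag}(1,q,\ldots,q,q^2)\Gamma_S .$$ For $\lambda\in\mathbb{Z}^{n+2}$ and $\mu\in\mathbb{Z}^n$ let $$M_\lambda=\begin{pmatrix}1&-\lambda^{tr}S_0&-\frac12S_0[\lambda]\\0&I&\lambda\\0&0&1\end{pmatrix},\quad K_\mu=\begin{pmatrix}1&\mu^{tr}S&\frac12S[\mu]\\0&I&\mu\\0&0&1\end{pmatrix},\quad\tilde K_\mu=\begin{pmatrix}1&0&0\\\mu&I&0\\\frac12S[\mu]&\mu^{tr}S&1\end{pmatrix},$$ where a matrix $K$ of size $n+2$ is identified with $\begin{pmatrix}1&0&0\\0&K&0\\0&0&1\end{pmatrix}$. Let $e_i$ denote unit vectors (of $\mathbb{Z}^{n+2}$ in $\lambda^*$, and of $\mathbb{Z}^n$ in $K_{re_j}$). Suppose that $q\nmid\det S$, and fix $r\in\mathbb{Z}$ with $q\nmid r$ and systems of representatives of $\mathbb{Z}^{n+2}$,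 $\mathbb{Z}^n$ and $\mathbb{Z}$ modulo $q$. Then a set of representatives of the right cosets $\Gamma_S\backslash\mathcal{T}_S(q)$ is given by the matrices * a) $\operatorname{diag}(1,q,\ldots,q,q^2)\,M_\lambda$, with $\lambda:\mathbb{Z}^{n+2}\bmod q$; * b) $\operatorname{diag}(q^2,q,\ldots,q,1)$; * c) $\operatorname{diag}(q,1,q,\ldots,q,q^2,q)\,K_\nu M_{\lambda^*}$, with $\nu:\mathbb{Z}^n\bmod q$, $\lambda^*=le_1$, $l:\mathbb{Z}\bmod q$; * d) $\operatorname{diag}(q,q^2,q,\ldots,q,1,q)\,M_{\lambda^*}$, with $\lambda^*=le_{n+2}$, $l:\mathbb{Z}\bmod q$; * e) $\operatorname{diag}(q,q^2,q,\ldots,q,1,q)\,\tilde K_\mu M_{\lambda^*}$, with $\lambda^*=le_{n+2}$, $l:\mathbb{Z}\bmod q$, $\mu:\mathbb{Z}^n\bmod q$, $\mu\not\equiv0\bmod q$, $\frac12S[\mu]\equiv0\bmod q$; * f) $\operatorname{diag}(q,q^2,q,\ldots,q,1,q)\,\tilde K_{\mu}K_{re_j}M_{\lambda^*}$, with $1\le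 j\le n$, $\lambda^*=le_{j+1}$, $l:\mathbb{Z}\bmod q$, $\mu:\mathbb{Z}^n\bmod q$, $\mu^{tr}S\equiv(\zeta_1,\ldots,\zeta_j,0,\ldots,0)\bmod q$ with $r\zeta_j\equiv-1\bmod q$, and $\frac12S[\mu]\equiv0\bmod q$. That is, all these matrices lie in $\mathcal{T}_S(q)$, and each $R\in\mathcal{T}_S(q)$ lies in $\Gamma_S R'$ for exactly one choice of the family and its parameters, where $R'$ is the corresponding matrix. -/

import Mathlib

open Matrix

/-- Three-part index set: a first index, the indices in `ι`, and a last index, in this order. -/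
abbrev Bd (ι : Type) : Type := Unit ⊕ (ι ⊕ Unit)

/-- Index set of the `n + 2` coordinates of the lattice `L₀`. -/
abbrev I0 (n : ℕ) : Type := Bd (Fin n)

/-- Index set of the `n + 4` coordinates of the lattice `L₁`. -/
abbrev I1 (n : ℕ) : Type := Bd (I0 n)

/-- The vector `(x, v, y)`. -/
def bvec {ι : Type} {X : Type} (x : X) (v : ι → X) (y : X) : Bd ι → X :=
  Sum.elim (fun _ => x) (Sum.elim v (fun _ => y))

/-- The `3 × 3` block matrix with rows `(α, aᵗ, β)`, `(b, K, c)`, `(γ, dᵗ, δ)`. -/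
def bord {ι : Type} {R : Type} (α : R) (a : ι → R) (β : R) (b : ι → R) (K : Matrix ι ι R)
    (c : ι → R) (γ : R) (d : ι → R) (δ : R) : Matrix (Bd ι) (Bd ι) R :=
  Matrix.of (bvec (bvec α a β) (fun i => bvec (b i) (K i) (c i)) (bvec γ d δ))

/-- `T[x] = xᵗ T x`. -/
def qf {ι : Type} [Fintype ι] {R : Type} [CommRing R] (T : Matrix ι ι R) (x : ι → R) : R :=
  x ⬝ᵥ (T *ᵥ x)

/-- The matrix with rows `(0, 0, 1)`, `(0, T, 0)`, `(1, 0, 0)`. -/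
def addHyp {ι : Type} {R : Type} [CommRing R] (T : Matrix ι ι R) : Matrix (Bd ι) (Bd ι) R :=
  bord 0 0 1 0 T 0 1 0 0

/-- The matrix `S₀`, of size `n + 2`. -/
def S0 {n : ℕ} {R : Type} [CommRing R] (S : Matrix (Fin n) (Fin n) R) : Matrix (I0 n) (I0 n) R :=
  addHyp (-S)

/-- The matrix `S₁`, of size `n + 4`. -/
def S1 {n : ℕ} {R : Type} [CommRing R] (S : Matrix (Fin n) (Fin n) R) : Matrix (I1 n) (I1 n) R :=
  addHyp (S0 S)

/-- The subgroup `ℤⁿ` of `ℚⁿ`. -/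
def stdLattice (n : ℕ) : AddSubgroup (Fin n → ℚ) :=
  (((Int.castRingHom ℚ).toAddMonoidHom).compLeft (Fin n)).range

/-- `S` takes only even integer values on the subgroup `L` of `ℚⁿ`. -/
def EvenOn {n : ℕ} (S : Matrix (Fin n) (Fin n) ℤ) (L : AddSubgroup (Fin n → ℚ)) : Prop :=
  ∀ x ∈ L, ∃ k : ℤ, qf (S.map (Int.cast : ℤ → ℚ)) x = 2 * (k : ℚ)

/-- `S` is (symmetric and) positive definite and maximal even: `ℤⁿ` is an even lattice with
respect to `S`, and no larger lattice is. -/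
structure PosDefMaxEven {n : ℕ} (S : Matrix (Fin n) (Fin n) ℤ) : Prop where
  posDef : (S.map (Int.cast : ℤ → ℝ)).PosDef
  maxEven : Maximal (EvenOn S) (stdLattice n)

/-- The orthogonal half-space `ℋ_S`, in the coordinates `w = (τ, z, τ')`. -/
def halfSpace {n : ℕ} (S : Matrix (Fin n) (Fin n) ℝ) : Set (I0 n → ℂ) :=
  {w | 0 < qf (S0 S) (fun i => (w i).im) ∧ 0 < (w (Sum.inl ())).im ∧
    0 < (w (Sum.inr (Sum.inr ()))).im}

/-- `S₀[w]` for complex `w`. -/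
noncomputable def qfC {n : ℕ} (S : Matrix (Fin n) (Fin n) ℝ) (w : I0 n → ℂ) : ℂ :=
  qf ((S0 S).map (Complex.ofReal)) w

/-- `M{w} = -(γ/2) S₀[w] + dᵗ w + δ`, where `(γ, dᵗ, δ)` is the last row of `M`. -/
noncomputable def autFactor {n : ℕ} (S : Matrix (Fin n) (Fin n) ℝ) (M : Matrix (I1 n) (I1 n) ℝ)
    (w : I0 n → ℂ) : ℂ :=
  -((M (Sum.inr (Sum.inr ())) (Sum.inl ()) : ℝ) : ℂ) / 2 * qfC S w
    + ∑ j : I0 n, ((M (Sum.inr (Sum.inr ())) (Sum.inr (Sum.inl j)) : ℝ) : ℂ) * w j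
    + ((M (Sum.inr (Sum.inr ())) (Sum.inr (Sum.inr ())) : ℝ) : ℂ)

/-- `M⟨w⟩ = (-(1/2) S₀[w] b + K w + c) M{w}⁻¹`, where `(b, K, c)` is the middle block row of `M`. -/
noncomputable def act {n : ℕ} (S : Matrix (Fin n) (Fin n) ℝ) (M : Matrix (I1 n) (I1 n) ℝ)
    (w : I0 n → ℂ) : I0 n → ℂ := fun i =>
  (-(1 / 2) * qfC S w * ((M (Sum.inr (Sum.inl i)) (Sum.inl ()) : ℝ) : ℂ)
    + ∑ j : I0 n, ((M (Sum.inr (Sum.inl i)) (Sum.inr (Sum.inl j)) : ℝ) : ℂ) * w j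
    + ((M (Sum.inr (Sum.inl i)) (Sum.inr (Sum.inr ())) : ℝ) : ℂ)) * (autFactor S M w)⁻¹

/-- `SO⁺(S₁; ℝ)`: the matrices of determinant `1` in the orthogonal group of `S₁` that map the
half-space onto itself. -/
def SOplus {n : ℕ} (S : Matrix (Fin n) (Fin n) ℝ) : Set (Matrix (I1 n) (I1 n) ℝ) :=
  {M | Mᵀ * S1 S * M = S1 S ∧ M.det = 1 ∧ act S M '' halfSpace S = halfSpace S}

/-- The discriminant kernel `Γ_S`; its elements have integer entries. -/
def GammaS {n : ℕ} (S : Matrix (Fin n) (Fin n) ℤ) : Set (Matrix (I1 n) (I1 n) ℤ) :=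
  {M | M.map (Int.cast : ℤ → ℝ) ∈ SOplus (S.map (Int.cast : ℤ → ℝ)) ∧
    ∃ X : Matrix (I1 n) (I1 n) ℤ, M = 1 + X * S1 S}

/-- `diag(1, q, …, q, q²)`. -/
def diagA (n : ℕ) (q : ℤ) : Matrix (I1 n) (I1 n) ℤ :=
  Matrix.diagonal (bvec 1 (fun _ => q) (q ^ 2))

/-- `diag(q², q, …, q, 1)`. -/
def diagB (n : ℕ) (q : ℤ) : Matrix (I1 n) (I1 n) ℤ :=
  Matrix.diagonal (bvec (q ^ 2) (fun _ => q) 1)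

/-- `diag(q, 1, q, …, q, q², q)`. -/
def diagC (n : ℕ) (q : ℤ) : Matrix (I1 n) (I1 n) ℤ :=
  Matrix.diagonal (bvec q (bvec 1 (fun _ => q) (q ^ 2)) q)

/-- `diag(q, q², q, …, q, 1, q)`. -/
def diagD (n : ℕ) (q : ℤ) : Matrix (I1 n) (I1 n) ℤ :=
  Matrix.diagonal (bvec q (bvec (q ^ 2) (fun _ => q) 1) q)

/-- The double coset `𝒯_S(q) = Γ_S diag(1, q, …, q, q²) Γ_S`. -/
def heckeT {n : ℕ} (S : Matrix (Fin n) (Fin n) ℤ) (q : ℕ) : Set (Matrix (I1 n) (I1 n) ℤ) :=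
  {R | ∃ γ ∈ GammaS S, ∃ γ' ∈ GammaS S, R = γ * diagA n q * γ'}

/-- The translation matrix `M_λ`. The division by `2` is exact when `S` is even. -/
def transM {n : ℕ} (S : Matrix (Fin n) (Fin n) ℤ) (lam : I0 n → ℤ) : Matrix (I1 n) (I1 n) ℤ :=
  bord 1 (-(lam ᵥ* S0 S)) (-(qf (S0 S) lam / 2)) 0 1 lam 0 0 1

/-- The embedding `K ↦ R_K` as the middle block. -/
def embR {n : ℕ} (K : Matrix (I0 n) (I0 n) ℤ) : Matrix (I1 n) (I1 n) ℤ :=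
  bord 1 0 0 0 K 0 0 0 1

/-- The matrix `K_μ`, of size `n + 2`. The division by `2` is exact when `S` is even. -/
def matK {n : ℕ} (S : Matrix (Fin n) (Fin n) ℤ) (mu : Fin n → ℤ) : Matrix (I0 n) (I0 n) ℤ :=
  bord 1 (mu ᵥ* S) (qf S mu / 2) 0 1 mu 0 0 1

/-- The matrix `K̃_μ`, of size `n + 2`. The division by `2` is exact when `S` is even. -/
def matKt {n : ℕ} (S : Matrix (Fin n) (Fin n) ℤ) (mu : Fin n → ℤ) : Matrix (I0 n) (I0 n) ℤ :=
  bord 1 0 0 mu 1 0 (qf S mu / 2) (mu ᵥ* S) 1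

/-- The unit vector `e₁` of `ℤⁿ⁺²`. -/
def eFirst (n : ℕ) : I0 n → ℤ := Pi.single (Sum.inl ()) 1

/-- The unit vector of `ℤⁿ⁺²` that has its `1` at the `j`-th of the `n` middle coordinates, which
is the coordinate number `j + 1` when `j` is counted from `1` to `n`. -/
def eMid {n : ℕ} (j : Fin n) : I0 n → ℤ := Pi.single (Sum.inr (Sum.inl j)) 1

/-- The unit vector `eₙ₊₂` of `ℤⁿ⁺²`. -/
def eLast (n : ℕ) : I0 n → ℤ := Pi.single (Sum.inr (Sum.inr ())) 1

/-- `A` is a complete system of representatives of `G / qG`. -/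
def IsResidueSystem {G : Type} [AddCommGroup G] (q : ℕ) (A : Set G) : Prop :=
  ∀ x : G, ∃! a : G, a ∈ A ∧ ∃ y : G, x - a = q • y

/-- The parameters of the six families of representatives. -/
inductive CosetIndex (n : ℕ) : Type
  | a (lam : I0 n → ℤ) : CosetIndex n
  | b : CosetIndex n
  | c (nu : Fin n → ℤ) (l : ℤ) : CosetIndex n
  | d (l : ℤ) : CosetIndex n
  | e (mu : Fin n → ℤ) (l : ℤ) : CosetIndex n
  | f (j : Fin n) (mu : Fin n → ℤ) (l : ℤ) : CosetIndex n

/-- The parameters that are allowed in the six families, where `A`, `N`, `L` are systems of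
representatives modulo `q` of `ℤⁿ⁺²`, `ℤⁿ` and `ℤ`. -/
def CosetIndex.Admissible {n : ℕ} (S : Matrix (Fin n) (Fin n) ℤ) (q : ℕ) (r : ℤ)
    (A : Set (I0 n → ℤ)) (N : Set (Fin n → ℤ)) (L : Set ℤ) : CosetIndex n → Prop
  | .a lam => lam ∈ A
  | .b => True
  | .c nu l => nu ∈ N ∧ l ∈ L
  | .d l => l ∈ L
  | .e mu l => mu ∈ N ∧ l ∈ L ∧ ¬ (∀ i, mu i ≡ 0 [ZMOD q]) ∧ qf S mu / 2 ≡ 0 [ZMOD q]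
  | .f j mu l => mu ∈ N ∧ l ∈ L ∧ (∀ i, j < i → (mu ᵥ* S) i ≡ 0 [ZMOD q]) ∧
      r * (mu ᵥ* S) j ≡ -1 [ZMOD q] ∧ qf S mu / 2 ≡ 0 [ZMOD q]

/-- The matrices of the six families. -/
def CosetIndex.rep {n : ℕ} (S : Matrix (Fin n) (Fin n) ℤ) (q : ℕ) (r : ℤ) :
    CosetIndex n → Matrix (I1 n) (I1 n) ℤ
  | .a lam => diagA n q * transM S lam
  | .b => diagB n q
  | .c nu l => diagC n q * embR (matK S nu) * transM S (l • eFirst n)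
  | .d l => diagD n q * transM S (l • eLast n)
  | .e mu l => diagD n q * embR (matKt S mu) * transM S (l • eLast n)
  | .f j mu l => diagD n q * embR (matKt S mu) * embR (matK S (Pi.single j r)) *
      transM S (l • eMid j)

/-! ### Calculus of bordered vectors and matrices. -/

section Block

variable {ι R : Type}

/-! Put D = diag(1, q, …, q, q²) and write e for the last unit vector. To R = γDγ' attach u = γ'⁻¹e,
an integral vector, isotropic for S₁ and nonzero modulo q. The proof shows that the right coset of R
is the same datum as the line spanned by u modulo q, and then sorts these lines.

Two elements γDγ' and δDδ' lie in the same right coset exactly when DgD⁻¹ belongs to Γ_S for g =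
γ'δ'⁻¹, and this holds exactly when g fixes the line of e modulo q (`HasLine.coset_iff`). The
substantial direction has two steps. If g⁻¹e is a multiple of e modulo q, isotropy and evenness
force DgD⁻¹ to be integral (`exists_conj_diagA`). An integral conjugate is automatically in Γ_S: D
is a similitude, it acts on the half-space by scaling, and q ∤ det S keeps the congruence condition
(`GammaS_conj_diagA`).

The listed matrices are products of diagonal matrices, which are conjugate or equivalent to D under
Γ_S by signed rotations, with unipotent elements of Γ_S. Hence they lie in the double coset, and
their lines are found by pulling a unit vector back through the factors (`hasLine_rep`). Membership
in Γ_S involves the half-space; it is checked through isotropic lifts of points to ℂⁿ⁺⁴, on which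
the action is linear (`mem_GammaS_iff`).

It remains to see that every isotropic line is listed once (`existsUnique_multMod_line`). For u =
(a, b, z, c, d) isotropy reads ad + bc = S[z]/2. Modulo q, the case d ≠ 0 is family a; d = 0 ≠ c is
family c; d = c = 0 ≠ b is family d or e according to whether z vanishes. If d = c = b = 0, then z =
0 is family b and z ≠ 0 is family f, where j is the last index with (zᵗS)_j ≠ 0; it exists because S
is invertible modulo q. In each case the scalar of proportionality and all parameters are
determined. -/

@[simp] theorem bvec_first {X : Type} (x : X) (v : ι → X) (y : X) :
    bvec x v y (Sum.inl ()) = x := rfl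

@[simp] theorem bvec_mid {X : Type} (x : X) (v : ι → X) (y : X) (i : ι) :
    bvec x v y (Sum.inr (Sum.inl i)) = v i := rfl

@[simp] theorem bvec_last {X : Type} (x : X) (v : ι → X) (y : X) :
    bvec x v y (Sum.inr (Sum.inr ())) = y := rfl

theorem Bd.forall_iff {p : Bd ι → Prop} :
    (∀ i, p i) ↔ p (Sum.inl ()) ∧ (∀ i, p (Sum.inr (Sum.inl i))) ∧ p (Sum.inr (Sum.inr ())) := by
  constructor
  · exact fun h => ⟨h _, fun _ => h _, h _⟩
  · rintro ⟨h₁, h₂, h₃⟩ (⟨⟩ | i | ⟨⟩)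
    exacts [h₁, h₂ i, h₃]

theorem bvec_eta {X : Type} (u : Bd ι → X) :
    bvec (u (Sum.inl ())) (fun i => u (Sum.inr (Sum.inl i))) (u (Sum.inr (Sum.inr ()))) = u := by
  funext i
  rcases i with ⟨⟩ | i | ⟨⟩ <;> rfl

theorem exists_bvec {X : Type} (u : Bd ι → X) : ∃ x v y, u = bvec x v y :=
  ⟨_, _, _, (bvec_eta u).symm⟩

theorem bvec_inj {X : Type} {x x' y y' : X} {v v' : ι → X} :
    bvec x v y = bvec x' v' y' ↔ x = x' ∧ v = v' ∧ y = y' := by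
  constructor
  · intro h
    exact ⟨congrFun h (Sum.inl ()), funext fun i => congrFun h (Sum.inr (Sum.inl i)),
      congrFun h (Sum.inr (Sum.inr ()))⟩
  · rintro ⟨rfl, rfl, rfl⟩
    rfl

theorem bvec_comp {X Y : Type} (f : X → Y) (x : X) (v : ι → X) (y : X) :
    (fun i => f (bvec x v y i)) = bvec (f x) (fun i => f (v i)) (f y) := by
  funext i
  rcases i with ⟨⟩ | i | ⟨⟩ <;> rfl

theorem bord_map {R' : Type} (f : R → R') (α : R) (a : ι → R) (β : R) (b : ι → R)
    (K : Matrix ι ι R) (c : ι → R) (γ : R) (d : ι → R) (δ : R) :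
    (bord α a β b K c γ d δ).map f =
      bord (f α) (fun i => f (a i)) (f β) (fun i => f (b i)) (K.map f) (fun i => f (c i)) (f γ)
        (fun i => f (d i)) (f δ) := by
  ext i j
  rcases i with ⟨⟩ | i | ⟨⟩ <;> rcases j with ⟨⟩ | j | ⟨⟩ <;> rfl

theorem bord_transpose (α : R) (a : ι → R) (β : R) (b : ι → R)
    (K : Matrix ι ι R) (c : ι → R) (γ : R) (d : ι → R) (δ : R) :
    (bord α a β b K c γ d δ)ᵀ = bord α b γ a Kᵀ d β c δ := by
  ext i j
  rcases i with ⟨⟩ | i | ⟨⟩ <;> rcases j with ⟨⟩ | j | ⟨⟩ <;> rfl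

/-- The reversal of the first and the last index. -/
def Bd.rev (ι : Type) : Bd ι ≃ Bd ι where
  toFun := bvec (Sum.inr (Sum.inr ())) (fun i => Sum.inr (Sum.inl i)) (Sum.inl ())
  invFun := bvec (Sum.inr (Sum.inr ())) (fun i => Sum.inr (Sum.inl i)) (Sum.inl ())
  left_inv := by rintro (⟨⟩ | i | ⟨⟩) <;> rfl
  right_inv := by rintro (⟨⟩ | i | ⟨⟩) <;> rfl

theorem bord_submatrix_rev (α : R) (a : ι → R) (β : R) (b : ι → R)
    (K : Matrix ι ι R) (c : ι → R) (γ : R) (d : ι → R) (δ : R) :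
    (bord α a β b K c γ d δ).submatrix (Bd.rev ι) (Bd.rev ι) = bord δ d γ c K b β a α := by
  ext i j
  rcases i with ⟨⟩ | i | ⟨⟩ <;> rcases j with ⟨⟩ | j | ⟨⟩ <;> rfl

variable [CommRing R]

theorem bvec_add (x x' y y' : R) (v v' : ι → R) :
    bvec x v y + bvec x' v' y' = bvec (x + x') (v + v') (y + y') := by
  funext i
  rcases i with ⟨⟩ | i | ⟨⟩ <;> rfl

theorem smul_bvec (k x y : R) (v : ι → R) : k • bvec x v y = bvec (k * x) (k • v) (k * y) := by
  funext i
  rcases i with ⟨⟩ | i | ⟨⟩ <;> rfl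

theorem bvec_zero : bvec (0 : R) (0 : ι → R) 0 = 0 := by
  funext i
  rcases i with ⟨⟩ | i | ⟨⟩ <;> rfl

theorem map_addHyp {R' : Type} [CommRing R'] (f : R →+* R') (T : Matrix ι ι R) :
    (addHyp T).map f = addHyp (T.map f) := by
  unfold addHyp
  rw [bord_map]
  simp
  rfl

theorem addHyp_transpose {T : Matrix ι ι R} (hT : Tᵀ = T) : (addHyp T)ᵀ = addHyp T := by
  rw [addHyp, bord_transpose, hT]

theorem addHyp_submatrix_rev (T : Matrix ι ι R) :
    (addHyp T).submatrix (Bd.rev ι) (Bd.rev ι) = addHyp T := by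
  rw [addHyp, bord_submatrix_rev]

variable [Fintype ι]

theorem dotProduct_bvec (x x' y y' : R) (v v' : ι → R) :
    bvec x v y ⬝ᵥ bvec x' v' y' = x * x' + v ⬝ᵥ v' + y * y' := by
  simp [dotProduct, Fintype.sum_sum_type, add_assoc]

theorem bord_mulVec (α : R) (a : ι → R) (β : R) (b : ι → R)
    (K : Matrix ι ι R) (c : ι → R) (γ : R) (d : ι → R) (δ : R) (x : R) (v : ι → R) (y : R) :
    bord α a β b K c γ d δ *ᵥ bvec x v y =
      bvec (α * x + a ⬝ᵥ v + β * y) (x • b + K *ᵥ v + y • c) (γ * x + d ⬝ᵥ v + δ * y) := by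
  funext i
  rcases i with ⟨⟩ | i | ⟨⟩
  · exact dotProduct_bvec α x β y a v
  · refine (dotProduct_bvec (b i) x (c i) y (K i) v).trans ?_
    simp [mulVec, mul_comm]
  · exact dotProduct_bvec γ x δ y d v

theorem addHyp_mulVec (T : Matrix ι ι R) (x : R) (v : ι → R) (y : R) :
    addHyp T *ᵥ bvec x v y = bvec y (T *ᵥ v) x := by
  simp [addHyp, bord_mulVec]

theorem addHyp_form (T : Matrix ι ι R) (x x' y y' : R) (v v' : ι → R) :
    bvec x v y ⬝ᵥ (addHyp T *ᵥ bvec x' v' y') = x * y' + v ⬝ᵥ (T *ᵥ v') + y * x' := by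
  rw [addHyp_mulVec, dotProduct_bvec]

theorem qf_addHyp (T : Matrix ι ι R) (x y : R) (v : ι → R) :
    qf (addHyp T) (bvec x v y) = 2 * (x * y) + qf T v := by
  rw [qf, addHyp_form, qf]
  ring

theorem dotProduct_mulVec_comm {T : Matrix ι ι R} (hT : Tᵀ = T) (x y : ι → R) :
    x ⬝ᵥ (T *ᵥ y) = y ⬝ᵥ (T *ᵥ x) := by
  rw [dotProduct_mulVec, dotProduct_comm, ← mulVec_transpose, hT]

/-- Matrix identities below are checked on a general vector `bvec x v y`, which avoids expanding
block products. -/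
theorem mulVec_ext [DecidableEq ι] {A B : Matrix ι ι R} (h : ∀ x, A *ᵥ x = B *ᵥ x) : A = B := by
  ext i j
  simpa using congrFun (h (Pi.single j 1)) i

theorem transpose_mul_mul_eq_iff [DecidableEq ι] {M B C : Matrix ι ι R} :
    Mᵀ * B * M = C ↔ ∀ x y, (M *ᵥ x) ⬝ᵥ (B *ᵥ (M *ᵥ y)) = x ⬝ᵥ (C *ᵥ y) := by
  have key : ∀ x y, (M *ᵥ x) ⬝ᵥ (B *ᵥ (M *ᵥ y)) = x ⬝ᵥ ((Mᵀ * B * M) *ᵥ y) := by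
    intro x y
    rw [← mulVec_mulVec, ← mulVec_mulVec, dotProduct_mulVec x, ← mulVec_transpose,
      transpose_transpose]
  constructor
  · intro h x y
    rw [key, h]
  · intro h
    ext i j
    have := (key (Pi.single i 1) (Pi.single j 1)).symm.trans (h (Pi.single i 1) (Pi.single j 1))
    simpa using this

theorem qf_mulVec [DecidableEq ι] {M B : Matrix ι ι R} (h : Mᵀ * B * M = B) (x : ι → R) :
    qf B (M *ᵥ x) = qf B x :=
  transpose_mul_mul_eq_iff.1 h x x

/-- The embedding of a matrix as the middle block. -/
def midBlock (K : Matrix ι ι R) : Matrix (Bd ι) (Bd ι) R := bord 1 0 0 0 K 0 0 0 1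

theorem midBlock_mulVec (K : Matrix ι ι R) (x : R) (v : ι → R) (y : R) :
    midBlock K *ᵥ bvec x v y = bvec x (K *ᵥ v) y := by
  simp [midBlock, bord_mulVec]

/-- The unipotent isometry attached to `lam`; `Q` stands for half of `T[lam]`. -/
def unip [DecidableEq ι] (T : Matrix ι ι R) (lam : ι → R) (Q : R) : Matrix (Bd ι) (Bd ι) R :=
  bord 1 (-(lam ᵥ* T)) (-Q) 0 1 lam 0 0 1

variable [DecidableEq ι]

theorem unip_mulVec {T : Matrix ι ι R} (lam : ι → R) (Q : R) (x : R) (v : ι → R) (y : R) :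
    unip T lam Q *ᵥ bvec x v y = bvec (x - lam ⬝ᵥ (T *ᵥ v) - Q * y) (v + y • lam) y := by
  rw [unip, bord_mulVec, bvec_inj]
  refine ⟨?_, ?_, ?_⟩
  · rw [neg_dotProduct, ← dotProduct_mulVec]
    ring
  · simp
  · simp

theorem unip_isometry {T : Matrix ι ι R} (hT : Tᵀ = T) {lam : ι → R} {Q : R}
    (hQ : qf T lam = 2 * Q) : (unip T lam Q)ᵀ * addHyp T * unip T lam Q = addHyp T := by
  rw [transpose_mul_mul_eq_iff]
  intro x y
  obtain ⟨x₁, v, x₂, rfl⟩ := exists_bvec x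
  obtain ⟨y₁, w, y₂, rfl⟩ := exists_bvec y
  simp only [unip_mulVec, addHyp_form, mulVec_add, mulVec_smul, dotProduct_add, add_dotProduct,
    dotProduct_smul, smul_dotProduct, smul_eq_mul]
  rw [dotProduct_mulVec_comm hT v lam]
  unfold qf at hQ
  rw [hQ]
  ring

/-- The same Q serves for lam and -lam because the form is even under sign change. Keeping Q as a
parameter avoids dividing by 2, so the calculus works over ℤ and ℂ alike. -/
theorem unip_mul_unip_neg {T : Matrix ι ι R} {lam : ι → R} {Q : R}
    (hQ : qf T lam = 2 * Q) : unip T lam Q * unip T (-lam) Q = 1 := by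
  apply mulVec_ext
  intro x
  obtain ⟨x₁, v, x₂, rfl⟩ := exists_bvec x
  unfold qf at hQ
  rw [← mulVec_mulVec, one_mulVec, unip_mulVec, unip_mulVec, bvec_inj]
  refine ⟨?_, ?_, rfl⟩
  · simp only [mulVec_add, mulVec_smul, dotProduct_add, dotProduct_smul, mulVec_neg,
      dotProduct_neg, neg_dotProduct, hQ, smul_eq_mul]
    ring
  · simp

theorem det_unip (T : Matrix ι ι R) (lam : ι → R) (Q : R) : (unip T lam Q).det = 1 := by
  have h : unip T lam Q = fromBlocks 1 (of fun _ => Sum.elim (-(lam ᵥ* T)) fun _ => -Q) 0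
      (fromBlocks 1 (of fun i _ => lam i) 0 1) := by
    ext i j
    rcases i with ⟨⟩ | i | ⟨⟩ <;> rcases j with ⟨⟩ | j | ⟨⟩ <;>
      simp [unip, bord, bvec, one_apply]
  rw [h, det_fromBlocks_zero₂₁, det_fromBlocks_zero₂₁]
  simp

/-- This is the congruence condition of the discriminant kernel. It needs no inverse of T, because T
already stands as a right factor in the only block where it occurs. -/
theorem unip_eq_one_add (T : Matrix ι ι R) (lam : ι → R) (Q : R) :
    unip T lam Q = 1 + bord (-Q) (-lam) 0 lam 0 0 0 0 0 * addHyp T := by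
  apply mulVec_ext
  intro x
  obtain ⟨x₁, v, x₂, rfl⟩ := exists_bvec x
  rw [add_mulVec, one_mulVec, ← mulVec_mulVec, addHyp_mulVec, bord_mulVec, unip_mulVec, bvec_add,
    bvec_inj]
  refine ⟨?_, ?_, ?_⟩
  · simp
    ring
  · simp
  · simp

theorem midBlock_isometry {T K : Matrix ι ι R} (h : Kᵀ * T * K = T) :
    (midBlock K)ᵀ * addHyp T * midBlock K = addHyp T := by
  rw [transpose_mul_mul_eq_iff] at h ⊢
  intro x y
  obtain ⟨x₁, v, x₂, rfl⟩ := exists_bvec x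
  obtain ⟨y₁, w, y₂, rfl⟩ := exists_bvec y
  simp only [midBlock_mulVec, addHyp_form, h]

theorem midBlock_mul (K K' : Matrix ι ι R) : midBlock K * midBlock K' = midBlock (K * K') := by
  apply mulVec_ext
  intro x
  obtain ⟨x₁, v, x₂, rfl⟩ := exists_bvec x
  simp [← mulVec_mulVec, midBlock_mulVec]

theorem midBlock_one : midBlock (1 : Matrix ι ι R) = 1 := by
  apply mulVec_ext
  intro x
  obtain ⟨x₁, v, x₂, rfl⟩ := exists_bvec x
  simp [midBlock_mulVec]

theorem det_midBlock (K : Matrix ι ι R) : (midBlock K).det = K.det := by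
  have h : midBlock K = fromBlocks 1 0 0 (fromBlocks K 0 0 1) := by
    ext i j
    rcases i with ⟨⟩ | i | ⟨⟩ <;> rcases j with ⟨⟩ | j | ⟨⟩ <;>
      simp [midBlock, bord, bvec, one_apply]
  rw [h, det_fromBlocks_zero₂₁, det_fromBlocks_zero₂₁]
  simp

theorem midBlock_eq_one_add {T K X : Matrix ι ι R} (h : K = 1 + X * T) :
    midBlock K = 1 + bord 0 0 0 0 X 0 0 0 0 * addHyp T := by
  apply mulVec_ext
  intro x
  obtain ⟨x₁, v, x₂, rfl⟩ := exists_bvec x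
  rw [add_mulVec, one_mulVec, ← mulVec_mulVec, addHyp_mulVec, bord_mulVec, midBlock_mulVec,
    bvec_add, bvec_inj, h]
  simp [add_mulVec, ← mulVec_mulVec]

/-- Replaces invertibility: applied twice, starting from the adjugate, it allows S₁ to be cancelled
on the right at the cost of a factor det S. -/
theorem exists_addHyp_mul {T T' : Matrix ι ι R} {d : R} (h : T * T' = d • (1 : Matrix ι ι R)) :
    ∃ T'' : Matrix (Bd ι) (Bd ι) R, addHyp T * T'' = d • (1 : Matrix (Bd ι) (Bd ι) R) := by
  refine ⟨bord 0 0 d 0 T' 0 d 0 0, mulVec_ext fun x => ?_⟩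
  obtain ⟨x₁, v, x₂, rfl⟩ := exists_bvec x
  rw [← mulVec_mulVec, bord_mulVec, addHyp_mulVec, smul_mulVec, one_mulVec, smul_bvec, bvec_inj]
  refine ⟨by simp, ?_, by simp⟩
  have := congrArg (· *ᵥ v) h
  simpa [← mulVec_mulVec, smul_mulVec] using this

end Block

/-! ### The action on the half-space through isotropic lifts, and the group structure of Γ_S. -/

section HalfSpace

variable {n : ℕ}

theorem S0_transpose {R : Type} [CommRing R] {S : Matrix (Fin n) (Fin n) R} (hS : Sᵀ = S) :
    (S0 S)ᵀ = S0 S :=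
  addHyp_transpose (by rw [transpose_neg, hS])

theorem map_S0 {R R' : Type} [CommRing R] [CommRing R'] (f : R →+* R')
    (S : Matrix (Fin n) (Fin n) R) : (S0 S).map f = S0 (S.map f) := by
  rw [S0, map_addHyp, S0]
  congr 1
  ext i j
  simp

theorem map_S1 {R R' : Type} [CommRing R] [CommRing R'] (f : R →+* R')
    (S : Matrix (Fin n) (Fin n) R) : (S1 S).map f = S1 (S.map f) := by
  rw [S1, map_addHyp, map_S0, S1]

/-- The isotropic vector `(-S₀[w]/2, w, 1)`. -/
noncomputable def liftVec (S : Matrix (Fin n) (Fin n) ℤ) (w : I0 n → ℂ) : I1 n → ℂ :=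
  bvec (-(1 / 2) * qf (S0 (S.map (Int.castRingHom ℂ))) w) w 1

/-- `M` maps the isotropic line over `w` to the one over `w'`. -/
def Sends (S : Matrix (Fin n) (Fin n) ℤ) (M : Matrix (I1 n) (I1 n) ℤ) (w w' : I0 n → ℂ) : Prop :=
  ∃ j : ℂ, j ≠ 0 ∧ M.map (Int.castRingHom ℂ) *ᵥ liftVec S w = j • liftVec S w'

/-- The half-space attached to an integral matrix. -/
abbrev halfSpaceInt (S : Matrix (Fin n) (Fin n) ℤ) : Set (I0 n → ℂ) :=
  halfSpace (S.map (Int.cast : ℤ → ℝ))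

variable {S : Matrix (Fin n) (Fin n) ℤ} {M N : Matrix (I1 n) (I1 n) ℤ} {w w' w'' : I0 n → ℂ}

theorem qf_liftVec (S : Matrix (Fin n) (Fin n) ℤ) (w : I0 n → ℂ) :
    qf (S1 (S.map (Int.castRingHom ℂ))) (liftVec S w) = 0 := by
  rw [S1, liftVec, qf_addHyp]
  ring

theorem Sends.mul (h : Sends S N w w') (h' : Sends S M w' w'') : Sends S (M * N) w w'' := by
  obtain ⟨j, hj, e⟩ := h
  obtain ⟨k, hk, e'⟩ := h'
  refine ⟨j * k, mul_ne_zero hj hk, ?_⟩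
  rw [Matrix.map_mul, ← mulVec_mulVec, e, mulVec_smul, e', smul_smul]

theorem Sends.symm (hMN : M * N = 1) (h : Sends S N w w') : Sends S M w' w := by
  obtain ⟨j, hj, e⟩ := h
  refine ⟨j⁻¹, inv_ne_zero hj, ?_⟩
  have := congrArg (M.map (Int.castRingHom ℂ) *ᵥ ·) e
  simp only [mulVec_mulVec, ← Matrix.map_mul, hMN, mulVec_smul] at this
  rw [Matrix.map_one _ (map_zero _) (map_one _), one_mulVec] at this
  rw [this, smul_smul, inv_mul_cancel₀ hj, one_smul]

theorem qfC_eq (S : Matrix (Fin n) (Fin n) ℤ) (w : I0 n → ℂ) :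
    qfC (S.map (Int.cast : ℤ → ℝ)) w = qf (S0 (S.map (Int.castRingHom ℂ))) w := by
  have := map_S0 Complex.ofRealHom (S.map (Int.cast : ℤ → ℝ))
  have h2 : (S.map (Int.cast : ℤ → ℝ)).map Complex.ofRealHom = S.map (Int.castRingHom ℂ) := by
    ext i j
    simp
  rw [h2] at this
  rw [qfC, ← this]
  rfl

theorem autFactor_eq (S : Matrix (Fin n) (Fin n) ℤ) (M : Matrix (I1 n) (I1 n) ℤ) (w : I0 n → ℂ) :
    autFactor (S.map (Int.cast : ℤ → ℝ)) (M.map (Int.cast : ℤ → ℝ)) w =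
      (M.map (Int.castRingHom ℂ) *ᵥ liftVec S w) (Sum.inr (Sum.inr ())) := by
  rw [autFactor, qfC_eq, mulVec, dotProduct, Fintype.sum_sum_type, Fintype.sum_sum_type]
  simp [liftVec]
  ring

theorem sum_Bd {ι R : Type} [Fintype ι] [CommRing R] (f : Bd ι → R) :
    ∑ i, f i = f (Sum.inl ()) + ∑ i, f (Sum.inr (Sum.inl i)) + f (Sum.inr (Sum.inr ())) := by
  simp [Fintype.sum_sum_type, add_assoc]

theorem act_eq (S : Matrix (Fin n) (Fin n) ℤ) (M : Matrix (I1 n) (I1 n) ℤ) (w : I0 n → ℂ)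
    (i : I0 n) :
    act (S.map (Int.cast : ℤ → ℝ)) (M.map (Int.cast : ℤ → ℝ)) w i =
      (M.map (Int.castRingHom ℂ) *ᵥ liftVec S w) (Sum.inr (Sum.inl i)) *
        ((M.map (Int.castRingHom ℂ) *ᵥ liftVec S w) (Sum.inr (Sum.inr ())))⁻¹ := by
  rw [act, autFactor_eq, qfC_eq]
  congr 1
  refine Eq.trans ?_ (sum_Bd fun k => M.map (Int.castRingHom ℂ) (Sum.inr (Sum.inl i)) k *
    liftVec S w k).symm
  simp only [liftVec, bvec_first, bvec_mid, bvec_last, map_apply, Complex.ofReal_intCast,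
    eq_intCast]
  ring

theorem Sends.act_eq (h : Sends S M w w') :
    act (S.map (Int.cast : ℤ → ℝ)) (M.map (Int.cast : ℤ → ℝ)) w = w' := by
  obtain ⟨j, hj, e⟩ := h
  funext i
  rw [_root_.act_eq, e]
  simp [liftVec]
  field_simp

theorem isometry_map {R : Type} [CommRing R] (f : ℤ →+* R) (h : Mᵀ * S1 S * M = S1 S) :
    (M.map f)ᵀ * S1 (S.map f) * M.map f = S1 (S.map f) := by
  rw [← map_S1, ← transpose_map, ← Matrix.map_mul, ← Matrix.map_mul, h]

/-- The image of a lift is again isotropic, so once its last coordinate is nonzero its first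
coordinate is forced by the others and need not be computed. -/
theorem sends_of_apply (h : Mᵀ * S1 S * M = S1 S) {j : ℂ} (hj : j ≠ 0)
    (hmid : ∀ i, (M.map (Int.castRingHom ℂ) *ᵥ liftVec S w) (Sum.inr (Sum.inl i)) = j * w' i)
    (hlast : (M.map (Int.castRingHom ℂ) *ᵥ liftVec S w) (Sum.inr (Sum.inr ())) = j) :
    Sends S M w w' := by
  refine ⟨j, hj, ?_⟩
  have hq := qf_mulVec (isometry_map (Int.castRingHom ℂ) h) (liftVec S w)
  rw [qf_liftVec] at hq
  generalize M.map (Int.castRingHom ℂ) *ᵥ liftVec S w = y at *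
  obtain ⟨y₁, v, y₂, rfl⟩ := exists_bvec y
  have hv : v = j • w' := funext hmid
  obtain rfl : y₂ = j := hlast
  subst hv
  rw [S1, qf_addHyp] at hq
  rw [liftVec, smul_bvec, bvec_inj]
  refine ⟨?_, rfl, by ring⟩
  simp only [qf, mulVec_smul, dotProduct_smul, smul_dotProduct, smul_eq_mul] at hq ⊢
  apply mul_left_cancel₀ hj
  linear_combination hq / 2

theorem im_pos_of_mem (h : w ∈ halfSpaceInt S) : 0 < (w (Sum.inl ())).im := h.2.1

theorem sends_act (h : Mᵀ * S1 S * M = S1 S)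
    (hw : act (S.map (Int.cast : ℤ → ℝ)) (M.map (Int.cast : ℤ → ℝ)) w ∈ halfSpaceInt S) :
    Sends S M w (act (S.map (Int.cast : ℤ → ℝ)) (M.map (Int.cast : ℤ → ℝ)) w) := by
  -- With the convention 0⁻¹ = 0, a vanishing automorphy factor would give the value 0, which has no
  -- positive imaginary part.
  have hj : (M.map (Int.castRingHom ℂ) *ᵥ liftVec S w) (Sum.inr (Sum.inr ())) ≠ 0 := by
    intro h0
    have := im_pos_of_mem hw
    rw [act_eq, h0] at this
    simp at this
  refine sends_of_apply h hj (fun i => ?_) rfl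
  rw [act_eq]
  field_simp

/-- `M` permutes the isotropic lines over the half-space. -/
def Preserves (S : Matrix (Fin n) (Fin n) ℤ) (M : Matrix (I1 n) (I1 n) ℤ) : Prop :=
  (∀ w ∈ halfSpaceInt S, ∃ w' ∈ halfSpaceInt S, Sends S M w w') ∧
    ∀ w' ∈ halfSpaceInt S, ∃ w ∈ halfSpaceInt S, Sends S M w w'

theorem Preserves.mul (hM : Preserves S M) (hN : Preserves S N) : Preserves S (M * N) := by
  constructor
  · intro w hw
    obtain ⟨w', hw', h⟩ := hN.1 w hw
    obtain ⟨w'', hw'', h'⟩ := hM.1 w' hw'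
    exact ⟨w'', hw'', h.mul h'⟩
  · intro w hw
    obtain ⟨w', hw', h⟩ := hM.2 w hw
    obtain ⟨w'', hw'', h'⟩ := hN.2 w' hw'
    exact ⟨w'', hw'', h'.mul h⟩

theorem Preserves.inv (hMN : M * N = 1) (hN : Preserves S N) : Preserves S M := by
  constructor
  · intro w hw
    obtain ⟨w', hw', h⟩ := hN.2 w hw
    exact ⟨w', hw', h.symm hMN⟩
  · intro w hw
    obtain ⟨w', hw', h⟩ := hN.1 w hw
    exact ⟨w', hw', h.symm hMN⟩

theorem preserves_of_mul_eq_one (hMN : M * N = 1)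
    (hM : ∀ w ∈ halfSpaceInt S, ∃ w' ∈ halfSpaceInt S, Sends S M w w')
    (hN : ∀ w ∈ halfSpaceInt S, ∃ w' ∈ halfSpaceInt S, Sends S N w w') : Preserves S M := by
  refine ⟨hM, fun w hw => ?_⟩
  obtain ⟨w', hw', h⟩ := hN w hw
  exact ⟨w', hw', h.symm hMN⟩

/-- Trades the real matrices and the fractional action for integral identities and a projective
linear action, where products and inverses are immediate. -/
theorem mem_GammaS_iff : M ∈ GammaS S ↔
    Mᵀ * S1 S * M = S1 S ∧ M.det = 1 ∧ Preserves S M ∧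
      ∃ X : Matrix (I1 n) (I1 n) ℤ, M = 1 + X * S1 S := by
  have h1 : (M.map (Int.cast : ℤ → ℝ))ᵀ * S1 (S.map (Int.cast : ℤ → ℝ)) *
      M.map (Int.cast : ℤ → ℝ) = S1 (S.map (Int.cast : ℤ → ℝ)) ↔ Mᵀ * S1 S * M = S1 S := by
    constructor
    · intro h
      have e : (Mᵀ * S1 S * M).map (Int.castRingHom ℝ) = (S1 S).map (Int.castRingHom ℝ) := by
        rw [Matrix.map_mul, Matrix.map_mul, map_S1, transpose_map]
        exact h
      ext i j
      have := congrFun (congrFun e i) j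
      simpa using this
    · exact isometry_map (Int.castRingHom ℝ)
  have h2 : (M.map (Int.cast : ℤ → ℝ)).det = 1 ↔ M.det = 1 := by
    have : (M.map (Int.cast : ℤ → ℝ)).det = (M.det : ℝ) :=
      ((Int.castRingHom ℝ).map_det M).symm
    rw [this]
    norm_cast
  have h3 : Mᵀ * S1 S * M = S1 S →
      (act (S.map (Int.cast : ℤ → ℝ)) (M.map (Int.cast : ℤ → ℝ)) '' halfSpaceInt S =
        halfSpaceInt S ↔ Preserves S M) := by
    intro h
    constructor
    · intro e
      constructor
      · intro w hw
        have hw' : act _ _ w ∈ halfSpaceInt S := e ▸ Set.mem_image_of_mem _ hw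
        exact ⟨_, hw', sends_act h hw'⟩
      · intro w' hw'
        obtain ⟨w, hw, hh⟩ := e.symm ▸ hw'
        refine ⟨w, hw, ?_⟩
        have := sends_act h (w := w) (by rw [hh]; exact hw')
        rwa [hh] at this
    · intro hP
      ext w'
      constructor
      · rintro ⟨w, hw, rfl⟩
        obtain ⟨w', hw', h'⟩ := hP.1 w hw
        rw [h'.act_eq]
        exact hw'
      · intro hw'
        obtain ⟨w, hw, h'⟩ := hP.2 w' hw'
        exact ⟨w, hw, h'.act_eq⟩
  constructor
  · rintro ⟨⟨a, b, c⟩, d⟩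
    have a' := h1.1 a
    exact ⟨a', h2.1 b, (h3 a').1 c, d⟩
  · rintro ⟨a, b, c, d⟩
    exact ⟨⟨h1.2 a, h2.2 b, (h3 a).2 c⟩, d⟩

theorem GammaS_mul_mem (hM : M ∈ GammaS S) (hN : N ∈ GammaS S) : M * N ∈ GammaS S := by
  rw [mem_GammaS_iff] at *
  obtain ⟨a, b, c, X, d⟩ := hM
  obtain ⟨a', b', c', Y, d'⟩ := hN
  refine ⟨?_, by rw [det_mul, b, b', one_mul], c.mul c', X + Y + X * S1 S * Y, ?_⟩
  · calc (M * N)ᵀ * S1 S * (M * N) = Nᵀ * (Mᵀ * S1 S * M) * N := by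
          rw [transpose_mul]; simp only [Matrix.mul_assoc]
      _ = S1 S := by rw [a, a']
  · rw [d, d']
    noncomm_ring

theorem GammaS_exists_inv (hM : M ∈ GammaS S) : ∃ N ∈ GammaS S, M * N = 1 ∧ N * M = 1 := by
  rw [mem_GammaS_iff] at hM
  obtain ⟨a, b, c, X, d⟩ := hM
  have hu : IsUnit M.det := by rw [b]; exact isUnit_one
  have h1 : M * M⁻¹ = 1 := mul_nonsing_inv M hu
  have h2 : M⁻¹ * M = 1 := nonsing_inv_mul M hu
  refine ⟨M⁻¹, mem_GammaS_iff.2 ⟨?_, ?_, c.inv h2, -(M⁻¹ * X), ?_⟩, h1, h2⟩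
  · calc (M⁻¹)ᵀ * S1 S * M⁻¹ = (M⁻¹)ᵀ * (Mᵀ * S1 S * M) * M⁻¹ := by rw [a]
      _ = (M * M⁻¹)ᵀ * S1 S * (M * M⁻¹) := by
          rw [transpose_mul]; simp only [Matrix.mul_assoc]
      _ = S1 S := by rw [h1]; simp
  · have := congrArg det h1
    rwa [det_mul, b, one_mul, det_one] at this
  · have : M⁻¹ * (1 + X * S1 S) = 1 := by rw [← d, h2]
    rw [mul_add, mul_one] at this
    rw [neg_mul, Matrix.mul_assoc, ← this]
    abel

theorem GammaS_one_mem : (1 : Matrix (I1 n) (I1 n) ℤ) ∈ GammaS S := by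
  rw [mem_GammaS_iff]
  have h : ∀ w, Sends S 1 w w := fun w => ⟨1, one_ne_zero, by
    rw [Matrix.map_one _ (map_zero _) (map_one _), one_mulVec, one_smul]⟩
  exact ⟨by simp, det_one, ⟨fun w hw => ⟨w, hw, h w⟩, fun w hw => ⟨w, hw, h w⟩⟩, 0, by simp⟩

theorem Sends.of_mul (h : Sends S (M * N) w w'') (h' : Sends S N w w') : Sends S M w' w'' := by
  obtain ⟨j, hj, e⟩ := h
  obtain ⟨k, hk, e'⟩ := h'
  refine ⟨k⁻¹ * j, mul_ne_zero (inv_ne_zero hk) hj, ?_⟩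
  rw [Matrix.map_mul, ← mulVec_mulVec, e', mulVec_smul] at e
  rw [mul_smul, ← e, smul_smul, inv_mul_cancel₀ hk, one_smul]

theorem conj_map_int {ι κ : Type} (A : Matrix ι κ ℤ) :
    (A.map (Int.castRingHom ℂ)).map (starRingEnd ℂ) = A.map (Int.castRingHom ℂ) := by
  ext i j
  simp

theorem conj_mulVec {ι κ : Type} [Fintype κ] (A : Matrix ι κ ℤ) (v : κ → ℂ) :
    (fun i => starRingEnd ℂ ((A.map (Int.castRingHom ℂ) *ᵥ v) i)) =
      A.map (Int.castRingHom ℂ) *ᵥ (fun i => starRingEnd ℂ (v i)) := by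
  funext i
  rw [RingHom.map_mulVec, conj_map_int]
  rfl

theorem conj_liftVec (S : Matrix (Fin n) (Fin n) ℤ) (w : I0 n → ℂ) :
    (fun i => starRingEnd ℂ (liftVec S w i)) = liftVec S (fun i => starRingEnd ℂ (w i)) := by
  rw [liftVec, bvec_comp, liftVec, bvec_inj]
  refine ⟨?_, rfl, by simp⟩
  rw [map_mul, qf, qf, RingHom.map_dotProduct, ← map_S0]
  have h2 : starRingEnd ℂ (-(1 / 2)) = -(1 / 2) := by
    rw [map_neg, map_div₀, map_one, map_ofNat]
  rw [h2, ← conj_mulVec (S0 S) w]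
  rfl

theorem liftVec_form (hS : Sᵀ = S) (w u : I0 n → ℂ) :
    liftVec S w ⬝ᵥ (S1 (S.map (Int.castRingHom ℂ)) *ᵥ liftVec S u) =
      -(1 / 2) * qf (S0 (S.map (Int.castRingHom ℂ))) (w - u) := by
  have hT : (S0 (S.map (Int.castRingHom ℂ)))ᵀ = S0 (S.map (Int.castRingHom ℂ)) :=
    S0_transpose (by rw [← transpose_map, hS])
  rw [liftVec, liftVec, S1, addHyp_form]
  simp only [qf, mulVec_sub, dotProduct_sub, sub_dotProduct]
  rw [dotProduct_mulVec_comm hT u w]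
  ring

theorem qf_sub_conj (S : Matrix (Fin n) (Fin n) ℤ) (w : I0 n → ℂ) :
    qf (S0 (S.map (Int.castRingHom ℂ))) (w - fun i => starRingEnd ℂ (w i)) =
      -4 * (qf (S0 (S.map (Int.cast : ℤ → ℝ))) (fun i => (w i).im) : ℝ) := by
  have h : (w - fun i => starRingEnd ℂ (w i)) =
      (2 * Complex.I) • (fun i => (((w i).im : ℝ) : ℂ)) := by
    funext i
    simp [Complex.sub_conj]
    ring
  have h2 : ((qf (S0 (S.map (Int.cast : ℤ → ℝ))) (fun i => (w i).im) : ℝ) : ℂ) =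
      qf (S0 (S.map (Int.castRingHom ℂ))) (fun i => (((w i).im : ℝ) : ℂ)) := by
    have := qfC_eq S (fun i => (((w i).im : ℝ) : ℂ))
    rw [← this, qfC, qf, qf]
    exact (RingHom.map_dotProduct Complex.ofRealHom _ _).trans
      (congrArg _ (funext fun i => RingHom.map_mulVec Complex.ofRealHom _ _ i))
  rw [h, h2]
  simp only [qf, mulVec_smul, dotProduct_smul, smul_dotProduct, smul_eq_mul]
  linear_combination (4 * ((fun i => (((w i).im : ℝ) : ℂ)) ⬝ᵥ S0 (S.map (Int.castRingHom ℂ)) *ᵥ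
    (fun i => (((w i).im : ℝ) : ℂ)))) * Complex.I_sq

/-- Pairing the lift of w with its complex conjugate gives 2 S₀[Im w]. An integral isometry commutes
with conjugation and preserves the pairing, whence |j|² S₀[Im w'] = S₀[Im w]. -/
theorem Sends.qf_im_pos (hS : Sᵀ = S) (hM : Mᵀ * S1 S * M = S1 S) (h : Sends S M w w')
    (hw : 0 < qf (S0 (S.map (Int.cast : ℤ → ℝ))) (fun i => (w i).im)) :
    0 < qf (S0 (S.map (Int.cast : ℤ → ℝ))) (fun i => (w' i).im) := by
  obtain ⟨j, hj, e⟩ := h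
  have e' := conj_mulVec M (liftVec S w)
  rw [e, conj_liftVec] at e'
  have e'' : (fun i => starRingEnd ℂ ((j • liftVec S w') i)) =
      (starRingEnd ℂ j) • liftVec S (fun i => starRingEnd ℂ (w' i)) := by
    rw [← conj_liftVec]
    funext i
    simp
  rw [e''] at e'
  have key := transpose_mul_mul_eq_iff.1 (isometry_map (Int.castRingHom ℂ) hM) (liftVec S w)
    (liftVec S (fun i => starRingEnd ℂ (w i)))
  rw [e, ← e', mulVec_smul, smul_dotProduct, dotProduct_smul, liftVec_form hS, liftVec_form hS,
    qf_sub_conj, qf_sub_conj, smul_eq_mul, smul_eq_mul, ← mul_assoc, Complex.mul_conj] at key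
  have key' : Complex.normSq j * qf (S0 (S.map (Int.cast : ℤ → ℝ))) (fun i => (w' i).im) =
      qf (S0 (S.map (Int.cast : ℤ → ℝ))) (fun i => (w i).im) := by
    have : ((Complex.normSq j * qf (S0 (S.map (Int.cast : ℤ → ℝ))) (fun i => (w' i).im) : ℝ) : ℂ)
        = (qf (S0 (S.map (Int.cast : ℤ → ℝ))) (fun i => (w i).im) : ℝ) := by
      push_cast
      linear_combination key / 2
    exact_mod_cast this
  rw [← key'] at hw
  exact pos_of_mul_pos_right hw (Complex.normSq_nonneg j)

theorem qf_S0_im (S : Matrix (Fin n) (Fin n) ℝ) (y : I0 n → ℝ) :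
    qf (S0 S) y = 2 * (y (Sum.inl ()) * y (Sum.inr (Sum.inr ()))) -
      qf S (fun i => y (Sum.inr (Sum.inl i))) := by
  conv_lhs => rw [← bvec_eta y]
  rw [S0, qf_addHyp]
  simp [qf, neg_mulVec, sub_eq_add_neg]

theorem qf_nonneg_of_posDef {S : Matrix (Fin n) (Fin n) ℝ} (hS : S.PosDef) (x : Fin n → ℝ) :
    0 ≤ qf S x := by
  simpa [qf] using hS.posSemidef.dotProduct_mulVec_nonneg x

/-- S₀[y] is twice the product of the outer coordinates minus S[z], and S[z] ≥ 0. -/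
theorem im_mul_im_pos (hS : (S.map (Int.cast : ℤ → ℝ)).PosDef)
    (h : 0 < qf (S0 (S.map (Int.cast : ℤ → ℝ))) (fun i => (w i).im)) :
    0 < (w (Sum.inl ())).im * (w (Sum.inr (Sum.inr ()))).im := by
  rw [qf_S0_im] at h
  have := qf_nonneg_of_posDef hS (fun i => (w (Sum.inr (Sum.inl i))).im)
  linarith

theorem symm_of_posDef (hS : (S.map (Int.cast : ℤ → ℝ)).PosDef) : Sᵀ = S := by
  have h := hS.isHermitian
  ext i j
  have := congrFun (congrFun h i) j
  simpa using this

/-- Positivity of S₀[Im w'] is automatic and makes the two outer imaginary parts agree in sign, so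
one of them decides membership. -/
theorem Sends.mem_of_first (hS : (S.map (Int.cast : ℤ → ℝ)).PosDef) (hM : Mᵀ * S1 S * M = S1 S)
    (h : Sends S M w w') (hw : w ∈ halfSpaceInt S) (h1 : 0 < (w' (Sum.inl ())).im) :
    w' ∈ halfSpaceInt S := by
  have hp := h.qf_im_pos (symm_of_posDef hS) hM hw.1
  exact ⟨hp, h1, pos_of_mul_pos_right (im_mul_im_pos hS hp) h1.le⟩

theorem Sends.mem_of_last (hS : (S.map (Int.cast : ℤ → ℝ)).PosDef) (hM : Mᵀ * S1 S * M = S1 S)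
    (h : Sends S M w w') (hw : w ∈ halfSpaceInt S) (h1 : 0 < (w' (Sum.inr (Sum.inr ()))).im) :
    w' ∈ halfSpaceInt S := by
  have hp := h.qf_im_pos (symm_of_posDef hS) hM hw.1
  exact ⟨hp, pos_of_mul_pos_left (im_mul_im_pos hS hp) h1.le, h1⟩

end HalfSpace

/-! ### Elements of Γ_S: rotations, translations and the matrices K_μ, K̃_μ. -/

section Generators

variable {n : ℕ}

/-! ### Signed quarter turns interchanging the two hyperbolic planes. -/

section Rotations

variable {R : Type} [CommRing R]

/-- The map `(x₁, x₂, z, x₃, x₄) ↦ (ε x₂, -ε x₁, z, -ε x₄, ε x₃)`. -/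
def rotC (n : ℕ) (ε : R) : Matrix (I1 n) (I1 n) R :=
  bord 0 (bvec ε 0 0) 0 (bvec (-ε) 0 0) (bord 0 0 0 0 1 0 0 0 0) (bvec 0 0 (-ε)) 0 (bvec 0 0 ε) 0

/-- The map `(x₁, x₂, z, x₃, x₄) ↦ (ε x₃, -ε x₄, z, -ε x₁, ε x₂)`. -/
def rotD (n : ℕ) (ε : R) : Matrix (I1 n) (I1 n) R :=
  bord 0 (bvec 0 0 ε) 0 (bvec 0 0 (-ε)) (bord 0 0 0 0 1 0 0 0 0) (bvec (-ε) 0 0) 0 (bvec ε 0 0) 0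

theorem rotC_mulVec (ε x₁ x₂ x₃ x₄ : R) (z : Fin n → R) :
    rotC n ε *ᵥ bvec x₁ (bvec x₂ z x₃) x₄ =
      bvec (ε * x₂) (bvec (-(ε * x₁)) z (-(ε * x₄))) (ε * x₃) := by
  simp [rotC, bord_mulVec, dotProduct_bvec, smul_bvec, bvec_add, mul_comm]

theorem rotD_mulVec (ε x₁ x₂ x₃ x₄ : R) (z : Fin n → R) :
    rotD n ε *ᵥ bvec x₁ (bvec x₂ z x₃) x₄ =
      bvec (ε * x₃) (bvec (-(ε * x₄)) z (-(ε * x₁))) (ε * x₂) := by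
  simp [rotD, bord_mulVec, dotProduct_bvec, smul_bvec, bvec_add, mul_comm]

theorem exists_bvec_bvec {X : Type} (u : I1 n → X) :
    ∃ x₁ x₂ z x₃ x₄, u = bvec x₁ (bvec x₂ z x₃) x₄ := by
  obtain ⟨x₁, v, x₄, rfl⟩ := exists_bvec u
  obtain ⟨x₂, z, x₃, rfl⟩ := exists_bvec v
  exact ⟨_, _, _, _, _, rfl⟩

theorem S1_form (S : Matrix (Fin n) (Fin n) R) (x₁ x₂ x₃ x₄ y₁ y₂ y₃ y₄ : R) (z w : Fin n → R) :
    bvec x₁ (bvec x₂ z x₃) x₄ ⬝ᵥ (S1 S *ᵥ bvec y₁ (bvec y₂ w y₃) y₄) =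
      x₁ * y₄ + (x₂ * y₃ - z ⬝ᵥ (S *ᵥ w) + x₃ * y₂) + x₄ * y₁ := by
  simp [S1, S0, addHyp_form, neg_mulVec, sub_eq_add_neg]

theorem S1_mulVec (S : Matrix (Fin n) (Fin n) R) (x₁ x₂ x₃ x₄ : R) (z : Fin n → R) :
    S1 S *ᵥ bvec x₁ (bvec x₂ z x₃) x₄ = bvec x₄ (bvec x₃ (-(S *ᵥ z)) x₂) x₁ := by
  simp [S1, S0, addHyp_mulVec, neg_mulVec]

theorem rotC_mul_rotC_neg {ε : R} (hε : ε * ε = 1) : rotC n ε * rotC n (-ε) = 1 := by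
  apply mulVec_ext
  intro x
  obtain ⟨x₁, x₂, z, x₃, x₄, rfl⟩ := exists_bvec_bvec x
  simp [← mulVec_mulVec, rotC_mulVec, ← mul_assoc, hε]

theorem rotD_mul_rotD_neg {ε : R} (hε : ε * ε = 1) : rotD n ε * rotD n (-ε) = 1 := by
  apply mulVec_ext
  intro x
  obtain ⟨x₁, x₂, z, x₃, x₄, rfl⟩ := exists_bvec_bvec x
  simp [← mulVec_mulVec, rotD_mulVec, ← mul_assoc, hε]

theorem rotC_isometry (S : Matrix (Fin n) (Fin n) R) {ε : R} (hε : ε * ε = 1) :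
    (rotC n ε)ᵀ * S1 S * rotC n ε = S1 S := by
  rw [transpose_mul_mul_eq_iff]
  intro x y
  obtain ⟨x₁, x₂, z, x₃, x₄, rfl⟩ := exists_bvec_bvec x
  obtain ⟨y₁, y₂, w, y₃, y₄, rfl⟩ := exists_bvec_bvec y
  rw [rotC_mulVec, rotC_mulVec, S1_form, S1_form]
  linear_combination (x₂ * y₃ + x₁ * y₄ + x₃ * y₂ + x₄ * y₁) * hε

theorem rotD_isometry (S : Matrix (Fin n) (Fin n) R) {ε : R} (hε : ε * ε = 1) :
    (rotD n ε)ᵀ * S1 S * rotD n ε = S1 S := by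
  rw [transpose_mul_mul_eq_iff]
  intro x y
  obtain ⟨x₁, x₂, z, x₃, x₄, rfl⟩ := exists_bvec_bvec x
  obtain ⟨y₁, y₂, w, y₃, y₄, rfl⟩ := exists_bvec_bvec y
  rw [rotD_mulVec, rotD_mulVec, S1_form, S1_form]
  linear_combination (x₂ * y₃ + x₁ * y₄ + x₃ * y₂ + x₄ * y₁) * hε

theorem bvec_sub {ι : Type} (x x' y y' : R) (v v' : ι → R) :
    bvec x v y - bvec x' v' y' = bvec (x - x') (v - v') (y - y') := by
  funext i
  rcases i with ⟨⟩ | i | ⟨⟩ <;> rfl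

theorem S0_zero_mulVec (x y : R) (z : Fin n → R) :
    S0 (0 : Matrix (Fin n) (Fin n) R) *ᵥ bvec x z y = bvec y 0 x := by
  simp [S0, addHyp_mulVec]

theorem unip_transpose_mulVec {ι : Type} [Fintype ι] [DecidableEq ι] (T : Matrix ι ι R)
    (lam : ι → R) (x : R) (v : ι → R) (y : R) :
    (unip T lam 0)ᵀ *ᵥ bvec x v y = bvec x (v - x • (Tᵀ *ᵥ lam)) (lam ⬝ᵥ v + y) := by
  rw [unip, bord_transpose, bord_mulVec, bvec_inj]
  refine ⟨by simp, ?_, by simp⟩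
  simp [mulVec_transpose, sub_eq_add_neg, add_comm]

theorem det_rotC {ε : R} (hε : ε * ε = 1) : (rotC n ε).det = 1 := by
  -- The analogue of writing a quarter turn in SL₂ as a product of three elementary matrices. The
  -- unipotents involve only outer coordinates, so S may be replaced by 0.
  have h : rotC n ε = unip (S0 0) (bvec 0 0 (-ε)) 0 * (unip (S0 0) (bvec 0 0 ε) 0)ᵀ *
      unip (S0 0) (bvec 0 0 (-ε)) 0 := by
    apply mulVec_ext
    intro x
    obtain ⟨x₁, x₂, z, x₃, x₄, rfl⟩ := exists_bvec_bvec x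
    simp only [rotC_mulVec, ← mulVec_mulVec, unip_mulVec, unip_transpose_mulVec, bvec_add,
      S0_transpose transpose_zero, smul_bvec, S0_zero_mulVec, dotProduct_bvec, bvec_sub, bvec_inj,
      zero_dotProduct, dotProduct_zero, smul_zero, add_zero, sub_zero, true_and]
    exact ⟨by linear_combination (x₁ + ε * x₂) * hε, ⟨by linear_combination x₂ * hε,
      by linear_combination (x₃ - ε * x₄) * hε⟩, by linear_combination x₄ * hε⟩
  rw [h, det_mul, det_mul, det_transpose, det_unip, det_unip]
  simp

theorem det_rotD {ε : R} (hε : ε * ε = 1) : (rotD n ε).det = 1 := by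
  have h : rotD n ε = unip (S0 0) (bvec (-ε) 0 0) 0 * (unip (S0 0) (bvec ε 0 0) 0)ᵀ *
      unip (S0 0) (bvec (-ε) 0 0) 0 := by
    apply mulVec_ext
    intro x
    obtain ⟨x₁, x₂, z, x₃, x₄, rfl⟩ := exists_bvec_bvec x
    simp only [rotD_mulVec, ← mulVec_mulVec, unip_mulVec, unip_transpose_mulVec, bvec_add,
      S0_transpose transpose_zero, smul_bvec, S0_zero_mulVec, dotProduct_bvec, bvec_sub, bvec_inj,
      zero_dotProduct, dotProduct_zero, smul_zero, add_zero, sub_zero, true_and]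
    exact ⟨by linear_combination (x₁ + ε * x₃) * hε, ⟨by linear_combination (x₂ - ε * x₄) * hε,
      by linear_combination x₃ * hε⟩, by linear_combination x₄ * hε⟩
  rw [h, det_mul, det_mul, det_transpose, det_unip, det_unip]
  simp

theorem rotC_eq_one_add (S : Matrix (Fin n) (Fin n) R) (ε : R) :
    rotC n ε = 1 + bord 0 (bvec 0 0 ε) (-1) (bvec 0 0 (-ε)) (bord 0 0 (-1) 0 0 0 (-1) 0 0)
      (bvec (-ε) 0 0) (-1) (bvec ε 0 0) 0 * S1 S := by
  apply mulVec_ext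
  intro x
  obtain ⟨x₁, x₂, z, x₃, x₄, rfl⟩ := exists_bvec_bvec x
  simp [add_mulVec, ← mulVec_mulVec, S1_mulVec, rotC_mulVec, bord_mulVec, dotProduct_bvec,
    smul_bvec, bvec_add, mul_comm]

theorem rotD_eq_one_add (S : Matrix (Fin n) (Fin n) R) (ε : R) :
    rotD n ε = 1 + bord 0 (bvec ε 0 0) (-1) (bvec (-ε) 0 0) (bord 0 0 (-1) 0 0 0 (-1) 0 0)
      (bvec 0 0 (-ε)) (-1) (bvec 0 0 ε) 0 * S1 S := by
  apply mulVec_ext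
  intro x
  obtain ⟨x₁, x₂, z, x₃, x₄, rfl⟩ := exists_bvec_bvec x
  simp [add_mulVec, ← mulVec_mulVec, S1_mulVec, rotD_mulVec, bord_mulVec, dotProduct_bvec,
    smul_bvec, bvec_add, mul_comm]

theorem map_rotC {R' : Type} [CommRing R'] (f : R →+* R') (ε : R) :
    (rotC n ε).map f = rotC n (f ε) := by
  simp only [rotC, bord_map, bvec_comp, map_zero, map_neg, Pi.zero_apply,
    Matrix.map_one f (map_zero f) (map_one f)]
  rfl

theorem map_rotD {R' : Type} [CommRing R'] (f : R →+* R') (ε : R) :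
    (rotD n ε).map f = rotD n (f ε) := by
  simp only [rotD, bord_map, bvec_comp, map_zero, map_neg, Pi.zero_apply,
    Matrix.map_one f (map_zero f) (map_one f)]
  rfl

end Rotations

theorem map_unip {ι R R' : Type} [CommRing R] [CommRing R'] [Fintype ι] [DecidableEq ι]
    (f : R →+* R') (T : Matrix ι ι R) (lam : ι → R) (Q : R) :
    (unip T lam Q).map f = unip (T.map f) (fun i => f (lam i)) (f Q) := by
  have h : (fun i => f ((-(lam ᵥ* T)) i)) = -((fun i => f (lam i)) ᵥ* T.map f) := by
    funext i
    rw [Pi.neg_apply, map_neg, RingHom.map_vecMul]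
    rfl
  simp only [unip, bord_map, h, map_zero, map_neg, map_one, Pi.zero_apply,
    Matrix.map_one f (map_zero f) (map_one f)]
  rfl

theorem map_midBlock {ι R R' : Type} [CommRing R] [CommRing R'] (f : R →+* R')
    (K : Matrix ι ι R) : (midBlock K).map f = midBlock (K.map f) := by
  simp only [midBlock, bord_map, map_zero, map_one, Pi.zero_apply]
  rfl

variable {S : Matrix (Fin n) (Fin n) ℤ} {w : I0 n → ℂ}

/-- Surjectivity on the half-space comes from the inverse mapping the half-space into itself, so
each generator needs only a forward computation for itself and its inverse. -/
theorem mem_GammaS_of_pair {M N : Matrix (I1 n) (I1 n) ℤ}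
    (hMN : M * N = 1) (hM : Mᵀ * S1 S * M = S1 S) (hdet : M.det = 1)
    (hX : ∃ X, M = 1 + X * S1 S)
    (h : ∀ w ∈ halfSpaceInt S, ∃ w' ∈ halfSpaceInt S, Sends S M w w')
    (h' : ∀ w ∈ halfSpaceInt S, ∃ w' ∈ halfSpaceInt S, Sends S N w w') : M ∈ GammaS S :=
  mem_GammaS_iff.2 ⟨hM, hdet, preserves_of_mul_eq_one hMN h h', hX⟩

theorem im_neg_one_div_pos {τ : ℂ} (h : 0 < τ.im) {ε : ℂ} (hε : ε * ε = 1) :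
    0 < (-ε / (ε * τ)).im := by
  have h0 : ε ≠ 0 := left_ne_zero_of_mul_eq_one hε
  rw [neg_div, div_mul_cancel_left₀ h0, Complex.neg_im, Complex.inv_im]
  have : 0 < Complex.normSq τ := Complex.normSq_pos.2 (by rintro rfl; simp at h)
  rw [neg_div, neg_neg]
  positivity

theorem rotC_sends (hS : (S.map (Int.cast : ℤ → ℝ)).PosDef) {ε : ℤ} (hε : ε * ε = 1)
    (hw : w ∈ halfSpaceInt S) : ∃ w' ∈ halfSpaceInt S, Sends S (rotC n ε) w w' := by
  have hε' : (ε : ℂ) * ε = 1 := by exact_mod_cast hε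
  have h0 : (ε : ℂ) ≠ 0 := left_ne_zero_of_mul_eq_one hε'
  have hτ : w (Sum.inr (Sum.inr ())) ≠ 0 := by
    intro h
    have := hw.2.2
    simp [h] at this
  obtain ⟨x₂, z, x₃, rfl⟩ := exists_bvec w
  have hj : (ε : ℂ) * x₃ ≠ 0 := mul_ne_zero h0 hτ
  have hs : Sends S (rotC n ε) (bvec x₂ z x₃)
      ((ε * x₃ : ℂ)⁻¹ • bvec (-(ε * (-(1 / 2) * qf (S0 (S.map (Int.castRingHom ℂ)))
        (bvec x₂ z x₃)))) z (-ε)) := by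
    refine sends_of_apply (rotC_isometry S hε) hj (fun i => ?_) ?_
    · rw [map_rotC, liftVec, rotC_mulVec, bvec_mid, Pi.smul_apply, smul_eq_mul,
        mul_inv_cancel_left₀ hj]
      simp
    · rw [map_rotC, liftVec, rotC_mulVec]
      simp
  -- The last coordinate of the image is -1/τ', which has positive imaginary part.
  refine ⟨_, hs.mem_of_last hS (rotC_isometry S hε) hw ?_, hs⟩
  have := im_neg_one_div_pos hw.2.2 hε'
  rwa [smul_bvec, bvec_last, mul_comm, ← div_eq_mul_inv]

theorem rotD_sends (hS : (S.map (Int.cast : ℤ → ℝ)).PosDef) {ε : ℤ} (hε : ε * ε = 1)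
    (hw : w ∈ halfSpaceInt S) : ∃ w' ∈ halfSpaceInt S, Sends S (rotD n ε) w w' := by
  have hε' : (ε : ℂ) * ε = 1 := by exact_mod_cast hε
  have h0 : (ε : ℂ) ≠ 0 := left_ne_zero_of_mul_eq_one hε'
  have hτ : w (Sum.inl ()) ≠ 0 := by
    intro h
    have := hw.2.1
    simp [h] at this
  obtain ⟨x₂, z, x₃, rfl⟩ := exists_bvec w
  have hj : (ε : ℂ) * x₂ ≠ 0 := mul_ne_zero h0 hτ
  have hs : Sends S (rotD n ε) (bvec x₂ z x₃)
      ((ε * x₂ : ℂ)⁻¹ • bvec (-(ε : ℂ)) z (-(ε * (-(1 / 2) * qf (S0 (S.map (Int.castRingHom ℂ)))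
        (bvec x₂ z x₃))))) := by
    refine sends_of_apply (rotD_isometry S hε) hj (fun i => ?_) ?_
    · rw [map_rotD, liftVec, rotD_mulVec, bvec_mid, Pi.smul_apply, smul_eq_mul,
        mul_inv_cancel_left₀ hj]
      simp
    · rw [map_rotD, liftVec, rotD_mulVec]
      simp
  refine ⟨_, hs.mem_of_first hS (rotD_isometry S hε) hw ?_, hs⟩
  have := im_neg_one_div_pos hw.2.1 hε'
  rwa [smul_bvec, bvec_first, mul_comm, ← div_eq_mul_inv]

theorem rotC_mem (hS : (S.map (Int.cast : ℤ → ℝ)).PosDef) {ε : ℤ} (hε : ε * ε = 1) :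
    rotC n ε ∈ GammaS S :=
  mem_GammaS_of_pair (rotC_mul_rotC_neg hε) (rotC_isometry S hε) (det_rotC hε)
    ⟨_, rotC_eq_one_add S ε⟩ (fun _ hw => rotC_sends hS hε hw)
    (fun _ hw => rotC_sends hS (by rwa [neg_mul_neg]) hw)

theorem rotD_mem (hS : (S.map (Int.cast : ℤ → ℝ)).PosDef) {ε : ℤ} (hε : ε * ε = 1) :
    rotD n ε ∈ GammaS S :=
  mem_GammaS_of_pair (rotD_mul_rotD_neg hε) (rotD_isometry S hε) (det_rotD hε)
    ⟨_, rotD_eq_one_add S ε⟩ (fun _ hw => rotD_sends hS hε hw)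
    (fun _ hw => rotD_sends hS (by rwa [neg_mul_neg]) hw)

/-- `S` takes even values on integral vectors. -/
def IsEvenForm (S : Matrix (Fin n) (Fin n) ℤ) : Prop := ∀ x : Fin n → ℤ, Even (qf S x)

theorem PosDefMaxEven.isEvenForm (hS : PosDefMaxEven S) : IsEvenForm S := by
  intro x
  obtain ⟨k, hk⟩ := hS.maxEven.1 (fun i => (x i : ℚ)) ⟨x, rfl⟩
  refine ⟨k, ?_⟩
  have h : ((qf S x : ℤ) : ℚ) = qf (S.map (Int.cast : ℤ → ℚ)) (fun i => (x i : ℚ)) := by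
    rw [qf, qf]
    exact (RingHom.map_dotProduct (Int.castRingHom ℚ) _ _).trans
      (congrArg _ (funext fun i => RingHom.map_mulVec (Int.castRingHom ℚ) _ _ i))
  rw [← h] at hk
  rw [← two_mul]
  exact_mod_cast hk

theorem IsEvenForm.two_mul_half (hE : IsEvenForm S) (x : Fin n → ℤ) :
    qf S x = 2 * (qf S x / 2) :=
  (Int.two_mul_ediv_two_of_even (hE x)).symm

theorem qf_S0 {R : Type} [CommRing R] (S : Matrix (Fin n) (Fin n) R) (x y : R) (z : Fin n → R) :
    qf (S0 S) (bvec x z y) = 2 * (x * y) - qf S z := by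
  rw [S0, qf_addHyp]
  simp [qf, neg_mulVec, sub_eq_add_neg]

theorem IsEvenForm.two_mul_half_S0 (hE : IsEvenForm S) (x : I0 n → ℤ) :
    qf (S0 S) x = 2 * (qf (S0 S) x / 2) := by
  refine (Int.two_mul_ediv_two_of_even ?_).symm
  obtain ⟨x₁, z, x₂, rfl⟩ := exists_bvec x
  rw [qf_S0]
  exact (even_two_mul _).sub (hE z)

theorem transM_eq_unip (S : Matrix (Fin n) (Fin n) ℤ) (lam : I0 n → ℤ) :
    transM S lam = unip (S0 S) lam (qf (S0 S) lam / 2) := rfl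

theorem qf_neg {ι R : Type} [Fintype ι] [CommRing R] (T : Matrix ι ι R) (x : ι → R) :
    qf T (-x) = qf T x := by
  simp [qf, mulVec_neg]

theorem transM_mul_transM_neg (hE : IsEvenForm S) (lam : I0 n → ℤ) :
    transM S lam * transM S (-lam) = 1 := by
  rw [transM_eq_unip, transM_eq_unip, qf_neg]
  exact unip_mul_unip_neg (hE.two_mul_half_S0 lam)

theorem transM_isometry (hS : Sᵀ = S) (hE : IsEvenForm S) (lam : I0 n → ℤ) :
    (transM S lam)ᵀ * S1 S * transM S lam = S1 S :=
  unip_isometry (S0_transpose hS) (hE.two_mul_half_S0 lam)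

theorem transM_sends (hS : Sᵀ = S) (hE : IsEvenForm S) (lam : I0 n → ℤ)
    (hw : w ∈ halfSpaceInt S) : ∃ w' ∈ halfSpaceInt S, Sends S (transM S lam) w w' := by
  refine ⟨w + fun i => (lam i : ℂ), ?_, ?_⟩
  · simpa [halfSpaceInt, halfSpace] using hw
  · refine sends_of_apply (transM_isometry hS hE lam) one_ne_zero (fun i => ?_) ?_
    · rw [transM_eq_unip, map_unip, liftVec, unip_mulVec]
      simp
    · rw [transM_eq_unip, map_unip, liftVec, unip_mulVec]
      simp

theorem transM_mem (hS : Sᵀ = S) (hE : IsEvenForm S) (lam : I0 n → ℤ) :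
    transM S lam ∈ GammaS S :=
  mem_GammaS_of_pair (transM_mul_transM_neg hE lam) (transM_isometry hS hE lam) (det_unip _ _ _)
    ⟨_, unip_eq_one_add _ _ _⟩ (fun _ hw => transM_sends hS hE lam hw)
    (fun _ hw => transM_sends hS hE (-lam) hw)

theorem embR_eq_midBlock (K : Matrix (I0 n) (I0 n) ℤ) : embR K = midBlock K := rfl

/-- K_μ is the translation-type unipotent one level down, for the form -S; its properties are
inherited from `unip`. -/
theorem matK_eq_unip (S : Matrix (Fin n) (Fin n) ℤ) (mu : Fin n → ℤ) :
    matK S mu = unip (-S) mu (-(qf S mu / 2)) := by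
  simp [matK, unip, vecMul_neg]

/-- Exchanging the two outer coordinates is an isometry of S₀, so everything about K̃_μ follows from
K_μ. -/
theorem matKt_eq_submatrix (S : Matrix (Fin n) (Fin n) ℤ) (mu : Fin n → ℤ) :
    matKt S mu = (matK S mu).submatrix (Bd.rev (Fin n)) (Bd.rev (Fin n)) := by
  rw [matK, bord_submatrix_rev, matKt]

theorem IsEvenForm.qf_neg_form (hE : IsEvenForm S) (mu : Fin n → ℤ) :
    qf (-S) mu = 2 * (-(qf S mu / 2)) := by
  have := hE.two_mul_half mu
  simp only [qf, neg_mulVec, dotProduct_neg] at *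
  linarith

theorem matK_mul_matK_neg (hE : IsEvenForm S) (mu : Fin n → ℤ) :
    matK S mu * matK S (-mu) = 1 := by
  rw [matK_eq_unip, matK_eq_unip, qf_neg]
  exact unip_mul_unip_neg (hE.qf_neg_form mu)

theorem matKt_mul_matKt_neg (hE : IsEvenForm S) (mu : Fin n → ℤ) :
    matKt S mu * matKt S (-mu) = 1 := by
  rw [matKt_eq_submatrix, matKt_eq_submatrix, submatrix_mul_equiv, matK_mul_matK_neg hE,
    submatrix_one_equiv]

theorem matK_isometry (hS : Sᵀ = S) (hE : IsEvenForm S) (mu : Fin n → ℤ) :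
    (matK S mu)ᵀ * S0 S * matK S mu = S0 S := by
  rw [matK_eq_unip]
  exact unip_isometry (by rw [transpose_neg, hS]) (hE.qf_neg_form mu)

theorem matKt_isometry (hS : Sᵀ = S) (hE : IsEvenForm S) (mu : Fin n → ℤ) :
    (matKt S mu)ᵀ * S0 S * matKt S mu = S0 S := by
  have h : S0 S = (S0 S).submatrix (Bd.rev (Fin n)) (Bd.rev (Fin n)) :=
    (addHyp_submatrix_rev _).symm
  rw [matKt_eq_submatrix, transpose_submatrix, h, submatrix_mul_equiv, submatrix_mul_equiv,
    matK_isometry hS hE]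

theorem exists_matK_eq (S : Matrix (Fin n) (Fin n) ℤ) (mu : Fin n → ℤ) :
    ∃ X, matK S mu = 1 + X * S0 S := by
  rw [matK_eq_unip]
  exact ⟨_, unip_eq_one_add _ _ _⟩

theorem exists_matKt_eq (S : Matrix (Fin n) (Fin n) ℤ) (mu : Fin n → ℤ) :
    ∃ X, matKt S mu = 1 + X * S0 S := by
  obtain ⟨X, hX⟩ := exists_matK_eq S mu
  refine ⟨X.submatrix (Bd.rev (Fin n)) (Bd.rev (Fin n)), ?_⟩
  have h : S0 S = (S0 S).submatrix (Bd.rev (Fin n)) (Bd.rev (Fin n)) :=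
    (addHyp_submatrix_rev _).symm
  rw [matKt_eq_submatrix, hX, h, submatrix_mul_equiv, ← h]
  ext i j
  simp [one_apply]

theorem embR_sends {K : Matrix (I0 n) (I0 n) ℤ} (hK : Kᵀ * S0 S * K = S0 S) (w : I0 n → ℂ) :
    Sends S (embR K) w (K.map (Int.castRingHom ℂ) *ᵥ w) := by
  refine sends_of_apply (midBlock_isometry hK) one_ne_zero (fun i => ?_) ?_
  · rw [embR_eq_midBlock, map_midBlock, liftVec, midBlock_mulVec, bvec_mid, one_mul]
  · rw [embR_eq_midBlock, map_midBlock, liftVec, midBlock_mulVec, bvec_last]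

theorem embR_matK_sends (hS : (S.map (Int.cast : ℤ → ℝ)).PosDef) (hE : IsEvenForm S)
    (mu : Fin n → ℤ) (hw : w ∈ halfSpaceInt S) :
    ∃ w' ∈ halfSpaceInt S, Sends S (embR (matK S mu)) w w' := by
  have hK := matK_isometry (symm_of_posDef hS) hE mu
  refine ⟨_, (embR_sends hK w).mem_of_last hS (midBlock_isometry hK) hw ?_, embR_sends hK w⟩
  have := hw.2.2
  obtain ⟨x₁, z, x₂, rfl⟩ := exists_bvec w
  rwa [matK_eq_unip, map_unip, unip_mulVec]

theorem embR_matKt_sends (hS : (S.map (Int.cast : ℤ → ℝ)).PosDef) (hE : IsEvenForm S)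
    (mu : Fin n → ℤ) (hw : w ∈ halfSpaceInt S) :
    ∃ w' ∈ halfSpaceInt S, Sends S (embR (matKt S mu)) w w' := by
  have hK := matKt_isometry (symm_of_posDef hS) hE mu
  refine ⟨_, (embR_sends hK w).mem_of_first hS (midBlock_isometry hK) hw ?_, embR_sends hK w⟩
  have := hw.2.1
  obtain ⟨x₁, z, x₂, rfl⟩ := exists_bvec w
  rw [matKt, bord_map, bord_mulVec, bvec_first]
  have h0 : (fun i : Fin n => (Int.castRingHom ℂ) ((0 : Fin n → ℤ) i)) = 0 := by
    funext i
    simp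
  rw [h0]
  simpa using this

theorem embR_mul_eq_one {K K' : Matrix (I0 n) (I0 n) ℤ} (h : K * K' = 1) :
    embR K * embR K' = 1 := by
  rw [embR_eq_midBlock, embR_eq_midBlock, midBlock_mul, h, midBlock_one]

theorem embR_matK_mem (hS : (S.map (Int.cast : ℤ → ℝ)).PosDef) (hE : IsEvenForm S)
    (mu : Fin n → ℤ) : embR (matK S mu) ∈ GammaS S := by
  obtain ⟨X, hX⟩ := exists_matK_eq S mu
  refine mem_GammaS_of_pair (embR_mul_eq_one (matK_mul_matK_neg hE mu))
    (midBlock_isometry (matK_isometry (symm_of_posDef hS) hE mu)) ?_ ⟨_, midBlock_eq_one_add hX⟩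
    (fun _ hw => embR_matK_sends hS hE mu hw) (fun _ hw => embR_matK_sends hS hE (-mu) hw)
  rw [embR_eq_midBlock, det_midBlock, matK_eq_unip, det_unip]

theorem embR_matKt_mem (hS : (S.map (Int.cast : ℤ → ℝ)).PosDef) (hE : IsEvenForm S)
    (mu : Fin n → ℤ) : embR (matKt S mu) ∈ GammaS S := by
  obtain ⟨X, hX⟩ := exists_matKt_eq S mu
  refine mem_GammaS_of_pair (embR_mul_eq_one (matKt_mul_matKt_neg hE mu))
    (midBlock_isometry (matKt_isometry (symm_of_posDef hS) hE mu)) ?_ ⟨_, midBlock_eq_one_add hX⟩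
    (fun _ hw => embR_matKt_sends hS hE mu hw) (fun _ hw => embR_matKt_sends hS hE (-mu) hw)
  rw [embR_eq_midBlock, det_midBlock, matKt_eq_submatrix, det_submatrix_equiv_self, matK_eq_unip,
    det_unip]

end Generators

/-! ### Right cosets in the double coset and isotropic lines modulo q. -/

section Cosets

variable {n : ℕ}

theorem diagonal_mulVec_bvec {ι R : Type} [Fintype ι] [DecidableEq ι] [CommRing R]
    (a b : R) (d : ι → R) (x y : R) (v : ι → R) :
    diagonal (bvec a d b) *ᵥ bvec x v y = bvec (a * x) (d * v) (b * y) := by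
  funext i
  rw [mulVec_diagonal]
  rcases i with ⟨⟩ | i | ⟨⟩ <;> rfl

theorem diagA_mulVec (q x y : ℤ) (v : I0 n → ℤ) :
    diagA n q *ᵥ bvec x v y = bvec x (q • v) (q ^ 2 * y) := by
  rw [diagA, diagonal_mulVec_bvec, one_mul]
  rfl

theorem diagB_mulVec (q x y : ℤ) (v : I0 n → ℤ) :
    diagB n q *ᵥ bvec x v y = bvec (q ^ 2 * x) (q • v) y := by
  rw [diagB, diagonal_mulVec_bvec, one_mul]
  rfl

theorem diagA_mul_diagB (q : ℤ) : diagA n q * diagB n q = q ^ 2 • 1 := by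
  apply mulVec_ext
  intro x
  obtain ⟨x₁, v, x₂, rfl⟩ := exists_bvec x
  rw [← mulVec_mulVec, diagB_mulVec, diagA_mulVec, smul_mulVec, one_mulVec, smul_bvec, smul_smul,
    sq]

theorem diagB_mul_diagA (q : ℤ) : diagB n q * diagA n q = q ^ 2 • 1 := by
  apply mulVec_ext
  intro x
  obtain ⟨x₁, v, x₂, rfl⟩ := exists_bvec x
  rw [← mulVec_mulVec, diagA_mulVec, diagB_mulVec, smul_mulVec, one_mulVec, smul_bvec, smul_smul,
    sq]

theorem S1_mul_diagB (S : Matrix (Fin n) (Fin n) ℤ) (q : ℤ) :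
    S1 S * diagB n q = diagA n q * S1 S := by
  apply mulVec_ext
  intro x
  obtain ⟨x₁, v, x₂, rfl⟩ := exists_bvec x
  simp only [S1, ← mulVec_mulVec, diagB_mulVec, addHyp_mulVec, diagA_mulVec, mulVec_smul]

/-- D is a similitude of S₁ with factor q²; `diagB` plays the role of q²D⁻¹ and keeps all
computations over ℤ. -/
theorem diagA_mul_S1_mul_diagA (S : Matrix (Fin n) (Fin n) ℤ) (q : ℤ) :
    diagA n q * S1 S * diagA n q = q ^ 2 • S1 S := by
  rw [← S1_mul_diagB, Matrix.mul_assoc, diagB_mul_diagA, mul_smul_comm, mul_one]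

theorem diagA_transpose (q : ℤ) : (diagA n q)ᵀ = diagA n q := diagonal_transpose _

theorem mul_diagA_cancel {q : ℤ} (hq : q ≠ 0) {A B : Matrix (I1 n) (I1 n) ℤ}
    (h : A * diagA n q = B * diagA n q) : A = B := by
  have := congrArg (· * diagB n q) h
  simp only [Matrix.mul_assoc, diagA_mul_diagB, mul_smul_comm, mul_one] at this
  exact smul_right_injective _ (pow_ne_zero 2 hq) this

theorem diagA_mul_cancel {q : ℤ} (hq : q ≠ 0) {A B : Matrix (I1 n) (I1 n) ℤ}
    (h : diagA n q * A = diagA n q * B) : A = B := by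
  have := congrArg (diagB n q * ·) h
  simp only [← Matrix.mul_assoc, diagB_mul_diagA, smul_mul_assoc, one_mul] at this
  exact smul_right_injective _ (pow_ne_zero 2 hq) this

variable {S : Matrix (Fin n) (Fin n) ℤ} {q : ℤ}

theorem diagA_sends (S : Matrix (Fin n) (Fin n) ℤ) (hq : q ≠ 0) (w : I0 n → ℂ) :
    Sends S (diagA n q) ((q : ℂ) • w) w := by
  refine ⟨(q : ℂ) ^ 2, pow_ne_zero 2 (by exact_mod_cast hq), ?_⟩
  have h : (diagA n q).map (Int.castRingHom ℂ) =
      diagonal (bvec 1 (fun _ => (q : ℂ)) ((q : ℂ) ^ 2)) := by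
    rw [diagA, diagonal_map (map_zero _)]
    congr 1
    refine (bvec_comp (Int.castRingHom ℂ) _ _ _).trans ?_
    simp
  rw [h, liftVec, diagonal_mulVec_bvec, liftVec, smul_bvec, bvec_inj]
  refine ⟨?_, ?_, rfl⟩
  · simp only [qf, mulVec_smul, dotProduct_smul, smul_dotProduct, smul_eq_mul]
    ring
  · funext i
    simp
    ring

theorem smul_mem_halfSpaceInt {c : ℝ} (hc : 0 < c) {w : I0 n → ℂ} (hw : w ∈ halfSpaceInt S) :
    (c : ℂ) • w ∈ halfSpaceInt S := by
  have h : ∀ i, (((c : ℂ) • w) i).im = c * (w i).im := fun i => by simp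
  obtain ⟨h1, h2, h3⟩ := hw
  refine ⟨?_, ?_, ?_⟩
  · have e : (fun i => (((c : ℂ) • w) i).im) = c • fun i => (w i).im := funext h
    rw [e]
    simp only [qf, mulVec_smul, dotProduct_smul, smul_dotProduct, smul_eq_mul] at h1 ⊢
    positivity
  · rw [h]
    positivity
  · rw [h]
    positivity

/-- D acts by w ↦ q⁻¹w, and positive scalings preserve the half-space. -/
theorem Preserves.conj_diagA (hq : 0 < q) {g h : Matrix (I1 n) (I1 n) ℤ}
    (e : diagA n q * g = h * diagA n q) (hg : Preserves S g) : Preserves S h := by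
  have hqR : (0 : ℝ) < q := by exact_mod_cast hq
  have hqC : (q : ℂ) ≠ 0 := by exact_mod_cast hq.ne'
  have up : ∀ w ∈ halfSpaceInt S, (q : ℂ) • w ∈ halfSpaceInt S := fun w hw => by
    simpa using smul_mem_halfSpaceInt hqR hw
  have down : ∀ w ∈ halfSpaceInt S, (q : ℂ)⁻¹ • w ∈ halfSpaceInt S := fun w hw => by
    simpa using smul_mem_halfSpaceInt (inv_pos.2 hqR) hw
  have hD : ∀ w, Sends S (diagA n q) w ((q : ℂ)⁻¹ • w) := fun w => by
    simpa [smul_smul, hqC] using diagA_sends S hq.ne' ((q : ℂ)⁻¹ • w)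
  constructor
  · intro w hw
    obtain ⟨w', hw', hs⟩ := hg.1 _ (up w hw)
    refine ⟨_, down w' hw', ?_⟩
    exact (e ▸ hs.mul (hD w')).of_mul (diagA_sends S hq.ne' w)
  · intro w hw
    obtain ⟨w', hw', hs⟩ := hg.2 _ (up w hw)
    exact ⟨_, down w' hw', (e ▸ hs.mul (diagA_sends S hq.ne' w)).of_mul (hD w')⟩

theorem exists_S1_mul_eq (S : Matrix (Fin n) (Fin n) ℤ) :
    ∃ T, S1 S * T = S.det • (1 : Matrix (I1 n) (I1 n) ℤ) := by
  have h : -S * -S.adjugate = S.det • 1 := by rw [neg_mul_neg, mul_adjugate]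
  obtain ⟨T, hT⟩ := exists_addHyp_mul h
  exact exists_addHyp_mul hT

/-- An integral conjugate h = DgD⁻¹ needs no further condition. The delicate point is the congruence
modulo S₁, which survives because q is coprime to det S. -/
theorem GammaS_conj_diagA (hq : 0 < q) (hqS : IsCoprime q S.det) {g h : Matrix (I1 n) (I1 n) ℤ}
    (e : diagA n q * g = h * diagA n q) (hg : g ∈ GammaS S) : h ∈ GammaS S := by
  rw [mem_GammaS_iff] at *
  obtain ⟨a, b, c, Y, d⟩ := hg
  refine ⟨?_, ?_, c.conj_diagA hq e, ?_⟩
  · apply diagA_mul_cancel hq.ne'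
    apply mul_diagA_cancel hq.ne'
    calc diagA n q * (hᵀ * S1 S * h) * diagA n q
        = (h * diagA n q)ᵀ * S1 S * (h * diagA n q) := by
          rw [transpose_mul, diagA_transpose]; simp only [Matrix.mul_assoc]
      _ = gᵀ * (diagA n q * S1 S * diagA n q) * g := by
          rw [← e, transpose_mul, diagA_transpose]; simp only [Matrix.mul_assoc]
      _ = diagA n q * S1 S * diagA n q := by
          rw [diagA_mul_S1_mul_diagA, mul_smul_comm, smul_mul_assoc, a]
  · have h0 : (diagA n q).det ≠ 0 := by
      have := congrArg det (diagA_mul_diagB (n := n) q)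
      rw [det_mul, det_smul, det_one, mul_one] at this
      exact left_ne_zero_of_mul (this ▸ pow_ne_zero _ (pow_ne_zero 2 hq.ne'))
    have := congrArg det e
    rw [det_mul, det_mul, b, mul_comm] at this
    exact (mul_right_cancel₀ h0 this).symm
  · obtain ⟨T, hT⟩ := exists_S1_mul_eq S
    -- From (h - 1)D = D(g - 1) = DYS₁, multiplied by q²D⁻¹, which moves across S₁ as D.
    have hZ : q ^ 2 • (h - 1) = diagA n q * Y * diagA n q * S1 S := by
      have : (h - 1) * diagA n q = diagA n q * Y * S1 S := by
        rw [sub_mul, ← e, d]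
        noncomm_ring
      have := congrArg (· * diagB n q) this
      simp only [Matrix.mul_assoc, diagA_mul_diagB, mul_smul_comm, mul_one, S1_mul_diagB] at this
      simpa only [Matrix.mul_assoc] using this
    -- Cancelling S₁ leaves q² dividing det S times the entries of DYD, and det S is prime to q.
    have hdiv : ∀ i j, q ^ 2 ∣ (diagA n q * Y * diagA n q) i j := by
      intro i j
      have e2 : q ^ 2 • ((h - 1) * T) = S.det • (diagA n q * Y * diagA n q) := by
        rw [← smul_mul_assoc, hZ, Matrix.mul_assoc _ _ T, hT, mul_smul_comm, mul_one]
      have e3 := congrFun (congrFun e2 i) j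
      simp only [Matrix.smul_apply, smul_eq_mul] at e3
      exact (hqS.pow_left).dvd_of_dvd_mul_left ⟨_, e3.symm⟩
    choose X hX using hdiv
    refine ⟨of X, ?_⟩
    have : q ^ 2 • (of X * S1 S) = q ^ 2 • (h - 1) := by
      rw [hZ, ← smul_mul_assoc]
      congr 1
      ext i j
      simp [hX]
    rw [smul_right_injective _ (pow_ne_zero 2 hq.ne') this]
    abel

theorem exists_bord {ι R : Type} (M : Matrix (Bd ι) (Bd ι) R) :
    ∃ α a β b K c γ d δ, M = bord α a β b K c γ d δ := by
  refine ⟨M (Sum.inl ()) (Sum.inl ()), fun j => M (Sum.inl ()) (Sum.inr (Sum.inl j)),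
    M (Sum.inl ()) (Sum.inr (Sum.inr ())), fun i => M (Sum.inr (Sum.inl i)) (Sum.inl ()),
    of fun i j => M (Sum.inr (Sum.inl i)) (Sum.inr (Sum.inl j)),
    fun i => M (Sum.inr (Sum.inl i)) (Sum.inr (Sum.inr ())), M (Sum.inr (Sum.inr ())) (Sum.inl ()),
    fun j => M (Sum.inr (Sum.inr ())) (Sum.inr (Sum.inl j)),
    M (Sum.inr (Sum.inr ())) (Sum.inr (Sum.inr ())), ?_⟩
  ext i j
  rcases i with ⟨⟩ | i | ⟨⟩ <;> rcases j with ⟨⟩ | j | ⟨⟩ <;> rfl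

/-- `u` is a multiple of `u'` modulo `q`. -/
def MultMod {ι : Type} (q : ℤ) (u u' : ι → ℤ) : Prop := ∃ (κ : ℤ) (t : ι → ℤ), u = κ • u' + q • t

theorem MultMod.mulVec {ι : Type} [Fintype ι] {u u' : ι → ℤ} (h : MultMod q u u')
    (M : Matrix ι ι ℤ) : MultMod q (M *ᵥ u) (M *ᵥ u') := by
  obtain ⟨κ, t, rfl⟩ := h
  exact ⟨κ, M *ᵥ t, by rw [mulVec_add, mulVec_smul, mulVec_smul]⟩

/-- Integrality of DgD⁻¹ means that in g the middle part of the first row and that of the last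
column are divisible by q and the upper right corner by q². Since g is an isometry with gu = e, its
first row is S₁u, so these divisibilities are read off from u. -/
theorem exists_conj_diagA (hE : IsEvenForm S) (hq : Prime q) (hq0 : 0 < q)
    (hqS : ¬ q ∣ S.det) {g : Matrix (I1 n) (I1 n) ℤ} (hg : g ∈ GammaS S) {u : I1 n → ℤ}
    (hu : g *ᵥ u = bvec 0 0 1) (hm : MultMod q u (bvec 0 0 1)) :
    ∃ h ∈ GammaS S, diagA n q * g = h * diagA n q := by
  have hor := (mem_GammaS_iff.1 hg).1
  have hrow : gᵀ *ᵥ bvec 1 0 0 = S1 S *ᵥ u := by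
    have : S1 S *ᵥ bvec 0 0 1 = bvec 1 0 0 := by rw [S1, addHyp_mulVec, mulVec_zero]
    rw [← this, ← hu, mulVec_mulVec, mulVec_mulVec, hor]
  have hiso : qf (S1 S) u = 0 := by
    rw [← qf_mulVec hor, hu, S1, qf_addHyp]
    simp [qf]
  obtain ⟨κ, t, rfl⟩ := hm
  obtain ⟨t₁, s, t₂, rfl⟩ := exists_bvec t
  obtain ⟨α, a, β, b, K, c, γ, d, δ, rfl⟩ := exists_bord g
  simp only [smul_bvec, bvec_add, mul_zero, smul_zero, zero_add, mul_one] at hu hrow hiso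
  rw [bord_transpose, bord_mulVec, S1, addHyp_mulVec, bvec_inj] at hrow
  rw [bord_mulVec, bvec_inj] at hu
  obtain ⟨r1, r2, r3⟩ := hrow
  obtain ⟨-, u2, u3⟩ := hu
  simp only [mul_one, dotProduct_zero, add_zero, mul_zero, mulVec_zero, zero_smul, one_smul]
    at r1 r2 r3
  subst r1 r2 r3
  -- Otherwise q would divide all of u, hence also gu = e.
  have hα : ¬ q ∣ κ + q * t₂ := by
    intro ⟨k, hk⟩
    rw [hk, dotProduct_smul, smul_eq_mul] at u3
    exact hq.not_dvd_one ⟨γ * t₁ + d ⬝ᵥ s + δ * k, by rw [← u3]; ring⟩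
  -- Isotropy of u, halved thanks to evenness of S₀, says αβ = -q²(S₀[s]/2); halving first is what
  -- covers q = 2.
  have hβ : q ^ 2 ∣ q * t₁ := by
    rw [S1, qf_addHyp] at hiso
    have h2 := hE.two_mul_half_S0 s
    simp only [qf, mulVec_smul, dotProduct_smul, smul_dotProduct, smul_eq_mul] at hiso h2
    rw [h2] at hiso
    refine IsCoprime.dvd_of_dvd_mul_right (z := κ + q * t₂)
      (IsCoprime.pow_left ((Prime.coprime_iff_not_dvd hq).2 hα)) ?_
    exact ⟨-((s ⬝ᵥ S0 S *ᵥ s) / 2), by linarith⟩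
  have hc : ∀ i, q ∣ c i := by
    intro i
    have := congrFun u2 i
    simp only [Pi.add_apply, Pi.smul_apply, mulVec_smul, smul_eq_mul, Pi.zero_apply] at this
    refine (hq.dvd_or_dvd ?_).resolve_left hα
    exact ⟨-(t₁ * b i + (K *ᵥ s) i), by linarith⟩
  obtain ⟨β', hβ'⟩ := hβ
  choose c' hc' using hc
  obtain rfl : c = q • c' := funext hc'
  -- The right-hand bordered matrix is DgD⁻¹ written out.
  have e : diagA n q * bord (κ + q * t₂) (S0 S *ᵥ q • s) (q * t₁) b K (q • c') γ d δ =
      bord (κ + q * t₂) (S0 S *ᵥ s) β' (q • b) K c' (q ^ 2 * γ) (q • d) δ * diagA n q := by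
    apply mulVec_ext
    intro x
    obtain ⟨x₁, v, x₂, rfl⟩ := exists_bvec x
    rw [← mulVec_mulVec, ← mulVec_mulVec, bord_mulVec, diagA_mulVec, diagA_mulVec, bord_mulVec,
      bvec_inj, hβ']
    refine ⟨?_, ?_, ?_⟩
    · simp only [mulVec_smul, smul_dotProduct, dotProduct_smul, smul_eq_mul]
      ring
    · funext i
      simp only [mulVec_smul, Pi.add_apply, Pi.smul_apply, smul_eq_mul]
      ring
    · simp only [smul_dotProduct, dotProduct_smul, smul_eq_mul]
      ring
  exact ⟨_, GammaS_conj_diagA hq0 ((Prime.coprime_iff_not_dvd hq).2 hqS) e hg, e⟩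

/-- `u` spans, modulo `q`, the image of `q² R⁻¹`, for `R` in the double coset. -/
def HasLine (S : Matrix (Fin n) (Fin n) ℤ) (q : ℤ) (R : Matrix (I1 n) (I1 n) ℤ) (u : I1 n → ℤ) :
    Prop :=
  ∃ γ ∈ GammaS S, ∃ γ' ∈ GammaS S, R = γ * diagA n q * γ' ∧ γ' *ᵥ u = bvec 0 0 1

theorem HasLine.qf_eq_zero {R : Matrix (I1 n) (I1 n) ℤ} {u : I1 n → ℤ} (h : HasLine S q R u) :
    qf (S1 S) u = 0 := by
  obtain ⟨γ, -, γ', hγ', -, hu⟩ := h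
  rw [← qf_mulVec (mem_GammaS_iff.1 hγ').1, hu, S1, qf_addHyp]
  simp [qf]

theorem HasLine.not_dvd {R : Matrix (I1 n) (I1 n) ℤ} {u : I1 n → ℤ} (h : HasLine S q R u)
    (hq : Prime q) : ¬ ∀ i, q ∣ u i := by
  obtain ⟨γ, -, γ', hγ', -, hu⟩ := h
  intro hd
  choose t ht using hd
  obtain rfl : u = q • t := funext ht
  rw [mulVec_smul] at hu
  have := congrFun hu (Sum.inr (Sum.inr ()))
  exact hq.not_dvd_one ⟨_, this.symm⟩

theorem exists_hasLine {q : ℕ} {R : Matrix (I1 n) (I1 n) ℤ} (hR : R ∈ heckeT S q) :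
    ∃ u, HasLine S q R u := by
  obtain ⟨γ, hγ, γ', hγ', rfl⟩ := hR
  obtain ⟨N, -, hN, -⟩ := GammaS_exists_inv hγ'
  exact ⟨N *ᵥ bvec 0 0 1, γ, hγ, γ', hγ', rfl, by rw [mulVec_mulVec, hN, one_mulVec]⟩

theorem HasLine.mem_heckeT {q : ℕ} {R : Matrix (I1 n) (I1 n) ℤ} {u : I1 n → ℤ}
    (h : HasLine S q R u) : R ∈ heckeT S q := by
  obtain ⟨γ, hγ, γ', hγ', rfl, -⟩ := h
  exact ⟨γ, hγ, γ', hγ', rfl⟩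

/-- Both sides say that g = BB'⁻¹ is conjugated by D into Γ_S. Taking R = R' shows in particular
that the line of R does not depend on the decomposition chosen in `HasLine`. -/
theorem HasLine.coset_iff (hE : IsEvenForm S) (hq : Prime q) (hq0 : 0 < q)
    (hqS : ¬ q ∣ S.det) {R R' : Matrix (I1 n) (I1 n) ℤ} {u u' : I1 n → ℤ}
    (h : HasLine S q R u) (h' : HasLine S q R' u') :
    (∃ γ ∈ GammaS S, R = γ * R') ↔ MultMod q u u' := by
  obtain ⟨A, hA, B, hB, rfl, hu⟩ := h
  obtain ⟨A', hA', B', hB', rfl, hu'⟩ := h'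
  obtain ⟨Ai, hAi, hAAi, hAiA⟩ := GammaS_exists_inv hA
  obtain ⟨A'i, hA'i, hAA'i, hA'iA⟩ := GammaS_exists_inv hA'
  obtain ⟨Bi, hBi, hBBi, hBiB⟩ := GammaS_exists_inv hB
  obtain ⟨B'i, hB'i, hBB'i, hB'iB⟩ := GammaS_exists_inv hB'
  constructor
  · rintro ⟨γ, hγ, e⟩
    have e1 : diagA n q * (B * B'i) = (Ai * γ * A') * diagA n q := by
      calc diagA n q * (B * B'i) = (Ai * A) * diagA n q * B * B'i := by
            rw [hAiA, one_mul, Matrix.mul_assoc]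
        _ = Ai * (A * diagA n q * B) * B'i := by simp only [Matrix.mul_assoc]
        _ = Ai * γ * A' * diagA n q * (B' * B'i) := by rw [e]; simp only [Matrix.mul_assoc]
        _ = _ := by rw [hBB'i, mul_one]
    obtain ⟨δ, hδ, hδ1, hδ2⟩ := GammaS_exists_inv (GammaS_mul_mem (GammaS_mul_mem hAi hγ) hA')
    have e2 : B' * Bi * diagB n q = diagB n q * δ := by
      have h2 : δ * diagA n q = diagA n q * (B' * Bi) := by
        calc δ * diagA n q = δ * (diagA n q * (B * B'i)) * (B' * Bi) := by
              have : B * B'i * (B' * Bi) = 1 := by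
                rw [Matrix.mul_assoc, ← Matrix.mul_assoc B'i, hB'iB, one_mul, hBBi]
              rw [Matrix.mul_assoc, Matrix.mul_assoc (diagA n q), this, mul_one]
          _ = δ * (Ai * γ * A') * diagA n q * (B' * Bi) := by
              rw [e1]; simp only [Matrix.mul_assoc]
          _ = _ := by rw [hδ2, one_mul]
      apply diagA_mul_cancel hq.ne_zero
      rw [← Matrix.mul_assoc, ← h2, Matrix.mul_assoc, diagA_mul_diagB, ← Matrix.mul_assoc,
        diagA_mul_diagB, mul_smul_comm, smul_mul_assoc, mul_one, one_mul]
    -- q²D⁻¹ fixes e and maps every vector to a multiple of e modulo q; hence B'B⁻¹e = q²D⁻¹(δe) is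
    -- such a multiple.
    have hm : MultMod q (B' *ᵥ u) (bvec 0 0 1) := by
      have h3 : B' *ᵥ u = diagB n q *ᵥ (δ *ᵥ bvec 0 0 1) := by
        have h4 : diagB n q *ᵥ bvec 0 0 1 = bvec 0 0 1 := by
          rw [diagB_mulVec, mul_zero, smul_zero]
        have h5 : u = Bi *ᵥ bvec 0 0 1 := by rw [← hu, mulVec_mulVec, hBiB, one_mulVec]
        rw [mulVec_mulVec, ← e2, ← mulVec_mulVec, h4, h5, mulVec_mulVec]
      rw [h3]
      obtain ⟨x₁, v, x₂, hx⟩ := exists_bvec (δ *ᵥ bvec 0 0 1)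
      rw [hx, diagB_mulVec]
      refine ⟨x₂, bvec (q * x₁) v 0, ?_⟩
      rw [smul_bvec, smul_bvec, bvec_add, bvec_inj]
      exact ⟨by ring, by simp, by ring⟩
    have := hm.mulVec B'i
    rwa [← hu', mulVec_mulVec, mulVec_mulVec, hB'iB, one_mulVec, one_mulVec] at this
  · intro hm
    have hm' := hm.mulVec B'
    rw [hu'] at hm'
    have hg : (B * B'i) *ᵥ (B' *ᵥ u) = bvec 0 0 1 := by
      rw [mulVec_mulVec, Matrix.mul_assoc, hB'iB, mul_one, hu]
    obtain ⟨h, hh, e⟩ := exists_conj_diagA hE hq hq0 hqS (GammaS_mul_mem hB hB'i) hg hm'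
    refine ⟨A * h * A'i, GammaS_mul_mem (GammaS_mul_mem hA hh) hA'i, ?_⟩
    calc A * diagA n q * B = A * (diagA n q * (B * B'i)) * B' := by
          simp only [Matrix.mul_assoc, hB'iB, mul_one]
      _ = A * h * (A'i * A') * diagA n q * B' := by
          rw [e, hA'iA, mul_one]; simp only [Matrix.mul_assoc]
      _ = _ := by simp only [Matrix.mul_assoc]

end Cosets

/-! ### The lines of the listed representatives. -/

section Lines

variable {n : ℕ} {S : Matrix (Fin n) (Fin n) ℤ}

/-- A vector spanning the line modulo `q` that belongs to a representative. -/
def CosetIndex.line (S : Matrix (Fin n) (Fin n) ℤ) (r : ℤ) : CosetIndex n → I1 n → ℤ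
  | .a lam => bvec (-(qf (S0 S) lam / 2)) (-lam) 1
  | .b => bvec 1 (bvec 0 0 0) 0
  | .c nu l => bvec l (bvec (qf S nu / 2) (-nu) 1) 0
  | .d l => bvec l (bvec 1 0 0) 0
  | .e mu l => bvec l (bvec 1 (-mu) (qf S mu / 2)) 0
  | .f j mu l => bvec (l * ((mu + (qf S mu / 2) • Pi.single j r) ᵥ* S) j)
      (bvec (1 + r * (mu ᵥ* S) j + qf S (Pi.single j r) / 2 * (qf S mu / 2))
        (-(mu + (qf S mu / 2) • Pi.single j r)) (qf S mu / 2)) 0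

theorem transM_mulVec (lam : I0 n → ℤ) (x y : ℤ) (v : I0 n → ℤ) :
    transM S lam *ᵥ bvec x v y =
      bvec (x - lam ⬝ᵥ (S0 S *ᵥ v) - qf (S0 S) lam / 2 * y) (v + y • lam) y :=
  unip_mulVec _ _ _ _ _

theorem embR_mulVec (K : Matrix (I0 n) (I0 n) ℤ) (x y : ℤ) (v : I0 n → ℤ) :
    embR K *ᵥ bvec x v y = bvec x (K *ᵥ v) y :=
  midBlock_mulVec _ _ _ _

theorem matK_mulVec (mu : Fin n → ℤ) (x y : ℤ) (v : Fin n → ℤ) :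
    matK S mu *ᵥ bvec x v y = bvec (x + mu ⬝ᵥ (S *ᵥ v) + qf S mu / 2 * y) (v + y • mu) y := by
  rw [matK_eq_unip, unip_mulVec, bvec_inj]
  refine ⟨?_, rfl, rfl⟩
  rw [neg_mulVec, dotProduct_neg]
  ring

theorem matKt_mulVec (mu : Fin n → ℤ) (x y : ℤ) (v : Fin n → ℤ) :
    matKt S mu *ᵥ bvec x v y = bvec x (v + x • mu) (qf S mu / 2 * x + mu ⬝ᵥ (S *ᵥ v) + y) := by
  rw [matKt, bord_mulVec, bvec_inj]
  refine ⟨by simp, by simp [add_comm], ?_⟩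
  rw [← dotProduct_mulVec]
  ring

theorem S0_mulVec (x y : ℤ) (z : Fin n → ℤ) :
    S0 S *ᵥ bvec x z y = bvec y (-(S *ᵥ z)) x := by
  rw [S0, addHyp_mulVec, neg_mulVec]

theorem diagonal_mulVec_bvec_bvec (q₁ q₂ q₃ q₄ q₅ : ℤ) (x₁ x₂ x₃ x₄ : ℤ) (z : Fin n → ℤ) :
    diagonal (bvec q₁ (bvec q₂ (fun _ => q₃) q₄) q₅) *ᵥ bvec x₁ (bvec x₂ z x₃) x₄ =
      bvec (q₁ * x₁) (bvec (q₂ * x₂) (q₃ • z) (q₄ * x₃)) (q₅ * x₄) := by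
  funext i
  rw [mulVec_diagonal]
  rcases i with ⟨⟩ | (⟨⟩ | i | ⟨⟩) | ⟨⟩ <;> rfl

theorem diagC_eq (q : ℤ) : diagC n q = rotC n (-1) * diagA n q * rotC n 1 := by
  apply mulVec_ext
  intro x
  obtain ⟨x₁, x₂, z, x₃, x₄, rfl⟩ := exists_bvec_bvec x
  simp only [← mulVec_mulVec, diagC, diagonal_mulVec_bvec_bvec, rotC_mulVec, diagA_mulVec,
    smul_bvec, bvec_inj, true_and]
  exact ⟨by ring, ⟨by ring, by ring⟩, by ring⟩

theorem diagD_eq (q : ℤ) : diagD n q = rotD n (-1) * diagA n q * rotD n 1 := by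
  apply mulVec_ext
  intro x
  obtain ⟨x₁, x₂, z, x₃, x₄, rfl⟩ := exists_bvec_bvec x
  simp only [← mulVec_mulVec, diagD, diagonal_mulVec_bvec_bvec, rotD_mulVec, diagA_mulVec,
    smul_bvec, bvec_inj, true_and]
  exact ⟨by ring, ⟨by ring, by ring⟩, by ring⟩

theorem diagB_eq (q : ℤ) :
    diagB n q = rotC n 1 * rotD n (-1) * diagA n q * (rotD n 1 * rotC n (-1)) := by
  apply mulVec_ext
  intro x
  obtain ⟨x₁, x₂, z, x₃, x₄, rfl⟩ := exists_bvec_bvec x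
  simp only [← mulVec_mulVec, diagB_mulVec, rotD_mulVec, rotC_mulVec, diagA_mulVec,
    smul_bvec, bvec_inj, true_and]
  exact ⟨by ring, ⟨by ring, by ring⟩, by ring⟩

/-- Right multiplication by M pulls the line back by M⁻¹, so the line of a product is found one
factor at a time, starting from the diagonal matrix. -/
theorem HasLine.mul_transform {q : ℤ} {R M : Matrix (I1 n) (I1 n) ℤ} {u v : I1 n → ℤ}
    (h : HasLine S q R v) (hM : M ∈ GammaS S) (hu : M *ᵥ u = v) : HasLine S q (R * M) u := by
  obtain ⟨γ, hγ, γ', hγ', rfl, e⟩ := h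
  exact ⟨γ, hγ, γ' * M, GammaS_mul_mem hγ' hM, by simp only [Matrix.mul_assoc],
    by rw [← mulVec_mulVec, hu, e]⟩

theorem hasLine_diagA (q : ℤ) : HasLine S q (diagA n q) (bvec 0 0 1) :=
  ⟨1, GammaS_one_mem, 1, GammaS_one_mem, by simp, one_mulVec _⟩

theorem hasLine_diagB (hS : (S.map (Int.cast : ℤ → ℝ)).PosDef) (q : ℤ) :
    HasLine S q (diagB n q) (bvec 1 (bvec 0 0 0) 0) :=
  ⟨_, GammaS_mul_mem (rotC_mem hS (by norm_num)) (rotD_mem hS (by norm_num)), _,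
    GammaS_mul_mem (rotD_mem hS (by norm_num)) (rotC_mem hS (by norm_num)), diagB_eq q, by
      rw [← mulVec_mulVec, rotC_mulVec, rotD_mulVec]
      simp [bvec_zero]⟩

theorem hasLine_diagC (hS : (S.map (Int.cast : ℤ → ℝ)).PosDef) (q : ℤ) :
    HasLine S q (diagC n q) (bvec 0 (bvec 0 0 1) 0) :=
  ⟨_, rotC_mem hS (by norm_num), _, rotC_mem hS (by norm_num), diagC_eq q, by
      simp [rotC_mulVec, bvec_zero]⟩

theorem hasLine_diagD (hS : (S.map (Int.cast : ℤ → ℝ)).PosDef) (q : ℤ) :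
    HasLine S q (diagD n q) (bvec 0 (bvec 1 0 0) 0) :=
  ⟨_, rotD_mem hS (by norm_num), _, rotD_mem hS (by norm_num), diagD_eq q, by
      simp [rotD_mulVec, bvec_zero]⟩

theorem eFirst_eq (n : ℕ) : eFirst n = bvec 1 0 0 := by
  funext i
  rcases i with ⟨⟩ | i | ⟨⟩ <;> rfl

theorem eLast_eq (n : ℕ) : eLast n = bvec 0 0 1 := by
  funext i
  rcases i with ⟨⟩ | i | ⟨⟩ <;> rfl

theorem eMid_eq (j : Fin n) : eMid j = bvec 0 (Pi.single j 1) 0 := by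
  funext i
  rcases i with ⟨⟩ | i | ⟨⟩
  · rfl
  · simp [eMid, Pi.single_apply]
  · rfl

/-- In family f, the line of K̃_μ is moved by the inverse of K_{re_j}. This adds r(μᵗS)_j to the
coordinate 1, up to multiples of S[μ]/2, so that the coordinate vanishes modulo q under the
condition on μ. -/
theorem hasLine_rep (hS : (S.map (Int.cast : ℤ → ℝ)).PosDef) (hE : IsEvenForm S) (q : ℕ) (r : ℤ)
    (i : CosetIndex n) : HasLine S q (i.rep S q r) (i.line S r) := by
  have hsymm := symm_of_posDef hS
  have htM := transM_mem hsymm hE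
  rcases i with lam | _ | ⟨nu, l⟩ | l | ⟨mu, l⟩ | ⟨j, mu, l⟩
  · refine (hasLine_diagA q).mul_transform (htM lam) ?_
    have := hE.two_mul_half_S0 lam
    rw [CosetIndex.line, transM_mulVec, mulVec_neg, dotProduct_neg, bvec_inj]
    rw [qf] at this ⊢
    exact ⟨by linarith, by simp, rfl⟩
  · exact hasLine_diagB hS q
  · refine ((hasLine_diagC hS q).mul_transform (embR_matK_mem hS hE nu)
      (u := bvec 0 (bvec (qf S nu / 2) (-nu) 1) 0) ?_).mul_transform (htM _) ?_
    · have := hE.two_mul_half nu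
      rw [embR_mulVec, matK_mulVec, mulVec_neg, dotProduct_neg, bvec_inj, bvec_inj]
      rw [qf] at this ⊢
      exact ⟨rfl, ⟨by linarith, by simp, rfl⟩, rfl⟩
    · rw [CosetIndex.line, transM_mulVec, S0_mulVec, eFirst_eq, smul_bvec, dotProduct_bvec,
        bvec_inj]
      exact ⟨by simp, by simp, rfl⟩
  · refine (hasLine_diagD hS q).mul_transform (htM _) ?_
    rw [CosetIndex.line, transM_mulVec, S0_mulVec, eLast_eq, smul_bvec, dotProduct_bvec,
      bvec_inj]
    exact ⟨by simp, by simp, rfl⟩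
  · refine ((hasLine_diagD hS q).mul_transform (embR_matKt_mem hS hE mu)
      (u := bvec 0 (bvec 1 (-mu) (qf S mu / 2)) 0) ?_).mul_transform (htM _) ?_
    · have := hE.two_mul_half mu
      rw [embR_mulVec, matKt_mulVec, mulVec_neg, dotProduct_neg, bvec_inj, bvec_inj]
      rw [qf] at this ⊢
      exact ⟨rfl, ⟨rfl, by simp, by linarith⟩, rfl⟩
    · rw [CosetIndex.line, transM_mulVec, S0_mulVec, eLast_eq, smul_bvec, dotProduct_bvec,
        bvec_inj]
      exact ⟨by simp, by simp, rfl⟩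
  · refine (((hasLine_diagD hS q).mul_transform (embR_matKt_mem hS hE mu)
      (u := bvec 0 (bvec 1 (-mu) (qf S mu / 2)) 0) ?_).mul_transform
      (embR_matK_mem hS hE (Pi.single j r))
      (u := bvec 0 (bvec (1 + r * (mu ᵥ* S) j + qf S (Pi.single j r) / 2 * (qf S mu / 2))
        (-(mu + (qf S mu / 2) • Pi.single j r)) (qf S mu / 2)) 0) ?_).mul_transform (htM _) ?_
    · have := hE.two_mul_half mu
      rw [embR_mulVec, matKt_mulVec, mulVec_neg, dotProduct_neg, bvec_inj, bvec_inj]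
      rw [qf] at this ⊢
      exact ⟨rfl, ⟨rfl, by simp, by linarith⟩, rfl⟩
    · have := hE.two_mul_half (Pi.single j r)
      rw [embR_mulVec, matK_mulVec, bvec_inj, bvec_inj]
      refine ⟨rfl, ⟨?_, ?_, rfl⟩, rfl⟩
      · rw [mulVec_neg, mulVec_add, mulVec_smul, dotProduct_neg, dotProduct_add, dotProduct_smul,
          ← qf, smul_eq_mul, single_dotProduct, ← mulVec_transpose, hsymm]
        linear_combination (-(qf S mu / 2)) * this
      · abel
    · rw [CosetIndex.line, transM_mulVec, S0_mulVec, eMid_eq, smul_bvec, dotProduct_bvec,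
        bvec_inj]
      refine ⟨?_, by simp, rfl⟩
      rw [mulVec_neg, neg_neg, ← hsymm, mulVec_transpose, hsymm,
        smul_dotProduct, single_dotProduct, smul_eq_mul]
      ring

end Lines

/-! ### Reduction modulo q. -/

section ModQ

variable {n : ℕ} {S : Matrix (Fin n) (Fin n) ℤ} {q : ℕ}

theorem IsResidueSystem.exists_pi {ι : Type} {A : Set (ι → ℤ)} (hA : IsResidueSystem q A)
    (f : ι → ZMod q) : ∃ a ∈ A, (∀ i, (a i : ZMod q) = f i) ∧
      ∀ a' ∈ A, (∀ i, (a' i : ZMod q) = f i) → a' = a := by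
  choose x hx using fun i => ZMod.intCast_surjective (f i)
  have key : ∀ a : ι → ℤ, (∃ y, x - a = q • y) ↔ ∀ i, (a i : ZMod q) = f i := by
    intro a
    have h1 : ∀ i, (a i : ZMod q) = f i ↔ (q : ℤ) ∣ x i - a i := fun i => by
      rw [← hx, ZMod.intCast_eq_intCast_iff_dvd_sub]
    simp only [h1]
    constructor
    · rintro ⟨y, hy⟩ i
      exact ⟨y i, by simpa using congrFun hy i⟩
    · intro h
      choose y hy using h
      exact ⟨y, funext fun i => by simpa using hy i⟩
  obtain ⟨a, ⟨ha, hy⟩, huniq⟩ := hA x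
  exact ⟨a, ha, (key a).1 hy, fun a' ha' h' => huniq a' ⟨ha', (key a').2 h'⟩⟩

theorem IsResidueSystem.exists_int {A : Set ℤ} (hA : IsResidueSystem q A)
    (f : ZMod q) : ∃ a ∈ A, (a : ZMod q) = f ∧ ∀ a' ∈ A, (a' : ZMod q) = f → a' = a := by
  obtain ⟨x, hx⟩ := ZMod.intCast_surjective f
  have key : ∀ a : ℤ, (∃ y : ℤ, x - a = q • y) ↔ (a : ZMod q) = f := by
    intro a
    rw [← hx, ZMod.intCast_eq_intCast_iff_dvd_sub]
    simp [Dvd.dvd]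
  obtain ⟨a, ⟨ha, hy⟩, huniq⟩ := hA x
  exact ⟨a, ha, (key a).1 hy, fun a' ha' h' => huniq a' ⟨ha', (key a').2 h'⟩⟩

theorem multMod_iff {ι : Type} {u u' : ι → ℤ} :
    MultMod q u u' ↔ ∃ κ : ZMod q, ∀ i, (u i : ZMod q) = κ * u' i := by
  constructor
  · rintro ⟨κ, t, rfl⟩
    exact ⟨κ, fun i => by simp⟩
  · rintro ⟨κ, h⟩
    obtain ⟨k, rfl⟩ := ZMod.intCast_surjective κ
    have h1 : ∀ i, (q : ℤ) ∣ u i - k * u' i := fun i => by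
      rw [← ZMod.intCast_eq_intCast_iff_dvd_sub, h]
      simp
    choose t ht using h1
    exact ⟨k, t, funext fun i => by simp [← ht]⟩

theorem multMod_bvec_iff {a b c d a' b' c' d' : ℤ} {z z' : Fin n → ℤ} :
    MultMod q (bvec a (bvec b z c) d) (bvec a' (bvec b' z' c') d') ↔
      ∃ κ : ZMod q, (a : ZMod q) = κ * a' ∧ (b : ZMod q) = κ * b' ∧
        (∀ i, (z i : ZMod q) = κ * z' i) ∧ (c : ZMod q) = κ * c' ∧ (d : ZMod q) = κ * d' := by
  rw [multMod_iff]
  simp only [Bd.forall_iff, bvec_first, bvec_mid, bvec_last, and_assoc]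

/-- Half of an even form is still quadratic modulo q, also for q = 2: changing x by qt alters it by
q times a bilinear value plus q² times an integral half-value. -/
theorem half_qf_congr {ι : Type} [Fintype ι] {T : Matrix ι ι ℤ} (hT : Tᵀ = T)
    (hE : ∀ x, qf T x = 2 * (qf T x / 2)) {x y : ι → ℤ} {κ : ZMod q}
    (h : ∀ i, (x i : ZMod q) = κ * y i) :
    ((qf T x / 2 : ℤ) : ZMod q) = κ ^ 2 * (qf T y / 2 : ℤ) := by
  obtain ⟨k, rfl⟩ := ZMod.intCast_surjective κ
  have h1 : ∀ i, (q : ℤ) ∣ x i - k * y i := fun i => by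
    rw [← ZMod.intCast_eq_intCast_iff_dvd_sub, h]
    simp
  choose t ht using h1
  have hx : x = k • y + (q : ℤ) • t := funext fun i => by simp [← ht]
  have e : qf T x = k ^ 2 * qf T y + 2 * (k * q * (y ⬝ᵥ (T *ᵥ t))) + q ^ 2 * qf T t := by
    rw [hx]
    simp only [qf, mulVec_add, mulVec_smul, dotProduct_add, add_dotProduct, dotProduct_smul,
      smul_dotProduct, smul_eq_mul]
    rw [dotProduct_mulVec_comm hT t y]
    ring
  have e2 : qf T x / 2 = k ^ 2 * (qf T y / 2) + q * (k * (y ⬝ᵥ (T *ᵥ t)) + q * (qf T t / 2)) := by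
    have h1 := hE x
    have h2 := hE y
    have h3 := hE t
    generalize qf T x / 2 = X at *
    generalize qf T y / 2 = Y at *
    generalize qf T t / 2 = Z at *
    rw [h1, h2, h3] at e
    linarith
  rw [e2]
  simp

theorem vecMul_congr (S : Matrix (Fin n) (Fin n) ℤ) {x y : Fin n → ℤ} {κ : ZMod q}
    (h : ∀ i, (x i : ZMod q) = κ * y i) (j : Fin n) :
    (((x ᵥ* S) j : ℤ) : ZMod q) = κ * ((y ᵥ* S) j : ℤ) := by
  simp only [vecMul, dotProduct, Int.cast_sum, Int.cast_mul, h, Finset.mul_sum, mul_assoc]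

/-- Multiplication by the adjugate turns xᵗS into det S · x, and det S is a unit modulo q. -/
theorem cast_eq_zero_of_vecMul [Fact q.Prime] (hqS : ¬ (q : ℤ) ∣ S.det) {x : Fin n → ℤ}
    (h : ∀ j, (((x ᵥ* S) j : ℤ) : ZMod q) = 0) (i : Fin n) : (x i : ZMod q) = 0 := by
  have h1 : (x ᵥ* S) ᵥ* S.adjugate = S.det • x := by
    rw [vecMul_vecMul, mul_adjugate, vecMul_smul, vecMul_one]
  have h2 := congrFun h1 i
  have h3 := vecMul_congr S.adjugate (x := x ᵥ* S) (y := 0) (κ := (0 : ZMod q))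
    (fun j => by rw [h j]; simp) i
  rw [h2] at h3
  have h4 : ((S.det : ℤ) : ZMod q) ≠ 0 := by
    rwa [Ne, ZMod.intCast_zmod_eq_zero_iff_dvd]
  simpa [h4] using h3

end ModQ

/-! ### Every isotropic line modulo q occurs exactly once. -/

section Classification

variable {n : ℕ} {S : Matrix (Fin n) (Fin n) ℤ} {q : ℕ} [Fact q.Prime] {r : ℤ}
  {a b c d : ℤ} {z : Fin n → ℤ}

/-- The coordinate 1 of the model vector forces the scalar to be d. The condition on the first
coordinate is then redundant, as isotropy determines it when d is invertible. -/
theorem multMod_line_a_iff (hS : Sᵀ = S) (hE : IsEvenForm S)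
    (hiso : a * d + b * c = qf S z / 2)
    (hu : ¬ ∀ i, (q : ℤ) ∣ bvec a (bvec b z c) d i) (lam : I0 n → ℤ) :
    MultMod q (bvec a (bvec b z c) d) (CosetIndex.line S r (.a lam)) ↔
      (d : ZMod q) ≠ 0 ∧ ∀ i, ((bvec b z c i : ℤ) : ZMod q) = -d * lam i := by
  rw [multMod_iff]
  simp only [CosetIndex.line, Bd.forall_iff (ι := I0 n), bvec_first, bvec_mid, bvec_last]
  constructor
  · rintro ⟨κ, h1, h2, h3⟩
    obtain rfl : (d : ZMod q) = κ := by simpa using h3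
    refine ⟨fun h0 => hu fun i => ?_, fun i => by rw [h2 i]; simp⟩
    rw [← ZMod.intCast_zmod_eq_zero_iff_dvd]
    revert i
    rw [Bd.forall_iff]
    simp only [bvec_first, bvec_mid, bvec_last]
    exact ⟨by rw [h1, h0, zero_mul], fun i => by rw [h2, h0, zero_mul], h0⟩
  · rintro ⟨h1, h2⟩
    refine ⟨d, ?_, fun i => by rw [h2 i]; simp, by simp⟩
    have h3 := half_qf_congr (S0_transpose hS) hE.two_mul_half_S0 h2
    have h4 : qf (S0 S) (bvec b z c) / 2 = b * c - qf S z / 2 := by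
      have := hE.two_mul_half z
      have := hE.two_mul_half_S0 (bvec b z c)
      have := qf_S0 S b c z
      linarith
    have h5 : qf (S0 S) (bvec b z c) / 2 = -(a * d) := by
      rw [h4, ← hiso]
      ring
    rw [h5] at h3
    apply mul_left_cancel₀ h1
    push_cast at h3 ⊢
    linear_combination -h3

theorem multMod_line_b_iff :
    MultMod q (bvec a (bvec b z c) d) (CosetIndex.line S r .b) ↔
      (d : ZMod q) = 0 ∧ (c : ZMod q) = 0 ∧ (b : ZMod q) = 0 ∧ ∀ i, (z i : ZMod q) = 0 := by
  rw [CosetIndex.line, multMod_bvec_iff]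
  constructor
  · rintro ⟨κ, h1, h2, h3, h4, h5⟩
    exact ⟨by simpa using h5, by simpa using h4, by simpa using h2, by simpa using h3⟩
  · rintro ⟨h1, h2, h3, h4⟩
    exact ⟨a, by simp, by simp [h3], by simp [h4], by simp [h2], by simp [h1]⟩

theorem not_dvd_iff (u : I1 n → ℤ) : (¬ ∀ i, (q : ℤ) ∣ u i) ↔ ¬ ∀ i, (u i : ZMod q) = 0 := by
  simp only [ZMod.intCast_zmod_eq_zero_iff_dvd]

/-- `MultMod` allows the multiple 0; a vector that is nonzero modulo q excludes it. -/
theorem multMod_ne_zero {u v : I1 n → ℤ} (hu : ¬ ∀ i, (q : ℤ) ∣ u i) {κ : ZMod q}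
    (h : ∀ i, (u i : ZMod q) = κ * v i) : κ ≠ 0 := by
  rintro rfl
  exact (not_dvd_iff u).1 hu fun i => by rw [h, zero_mul]

theorem multMod_bvec_iff_ne_zero (hu : ¬ ∀ i, (q : ℤ) ∣ bvec a (bvec b z c) d i)
    {a' b' c' d' : ℤ} {z' : Fin n → ℤ} :
    MultMod q (bvec a (bvec b z c) d) (bvec a' (bvec b' z' c') d') ↔
      ∃ κ : ZMod q, κ ≠ 0 ∧ (a : ZMod q) = κ * a' ∧ (b : ZMod q) = κ * b' ∧
        (∀ i, (z i : ZMod q) = κ * z' i) ∧ (c : ZMod q) = κ * c' ∧ (d : ZMod q) = κ * d' := by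
  rw [multMod_bvec_iff]
  constructor
  · rintro ⟨κ, h⟩
    refine ⟨κ, multMod_ne_zero hu (v := bvec a' (bvec b' z' c') d') ?_, h⟩
    simpa only [Bd.forall_iff, bvec_first, bvec_mid, bvec_last, and_assoc] using h
  · rintro ⟨κ, -, h⟩
    exact ⟨κ, h⟩

/-- Here the scalar is c, and with d = 0 isotropy determines b. -/
theorem multMod_line_c_iff (hS : Sᵀ = S) (hE : IsEvenForm S)
    (hiso : a * d + b * c = qf S z / 2)
    (hu : ¬ ∀ i, (q : ℤ) ∣ bvec a (bvec b z c) d i) (nu : Fin n → ℤ) (l : ℤ) :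
    MultMod q (bvec a (bvec b z c) d) (CosetIndex.line S r (.c nu l)) ↔
      (d : ZMod q) = 0 ∧ (c : ZMod q) ≠ 0 ∧ (∀ i, (z i : ZMod q) = -c * nu i) ∧
        (a : ZMod q) = c * l := by
  rw [CosetIndex.line, multMod_bvec_iff_ne_zero hu]
  constructor
  · rintro ⟨κ, hκ, h1, h2, h3, h4, h5⟩
    obtain rfl : (c : ZMod q) = κ := by simpa using h4
    exact ⟨by simpa using h5, hκ, fun i => by rw [h3]; simp, h1⟩
  · rintro ⟨h1, h2, h3, h4⟩
    refine ⟨c, h2, h4, ?_, fun i => by rw [h3]; simp, by simp, by simp [h1]⟩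
    have h5 := half_qf_congr hS hE.two_mul_half h3
    rw [← hiso] at h5
    apply mul_left_cancel₀ h2
    push_cast [h1] at h5
    linear_combination h5

theorem multMod_line_d_iff (hu : ¬ ∀ i, (q : ℤ) ∣ bvec a (bvec b z c) d i) (l : ℤ) :
    MultMod q (bvec a (bvec b z c) d) (CosetIndex.line S r (.d l)) ↔
      (d : ZMod q) = 0 ∧ (c : ZMod q) = 0 ∧ (b : ZMod q) ≠ 0 ∧ (∀ i, (z i : ZMod q) = 0) ∧
        (a : ZMod q) = b * l := by
  rw [CosetIndex.line, multMod_bvec_iff_ne_zero hu]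
  constructor
  · rintro ⟨κ, hκ, h1, h2, h3, h4, h5⟩
    obtain rfl : (b : ZMod q) = κ := by simpa using h2
    exact ⟨by simpa using h5, by simpa using h4, hκ, by simpa using h3, h1⟩
  · rintro ⟨h1, h2, h3, h4, h5⟩
    exact ⟨b, h3, h5, by simp, by simp [h4], by simp [h2], by simp [h1]⟩

theorem multMod_line_e_iff (hu : ¬ ∀ i, (q : ℤ) ∣ bvec a (bvec b z c) d i) {mu : Fin n → ℤ}
    (hmu : ((qf S mu / 2 : ℤ) : ZMod q) = 0) (l : ℤ) :
    MultMod q (bvec a (bvec b z c) d) (CosetIndex.line S r (.e mu l)) ↔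
      (d : ZMod q) = 0 ∧ (c : ZMod q) = 0 ∧ (b : ZMod q) ≠ 0 ∧
        (∀ i, (z i : ZMod q) = -b * mu i) ∧ (a : ZMod q) = b * l := by
  rw [CosetIndex.line, multMod_bvec_iff_ne_zero hu]
  constructor
  · rintro ⟨κ, hκ, h1, h2, h3, h4, h5⟩
    obtain rfl : (b : ZMod q) = κ := by simpa using h2
    exact ⟨by simpa using h5, by simpa [hmu] using h4, hκ, fun i => by rw [h3]; simp, h1⟩
  · rintro ⟨h1, h2, h3, h4, h5⟩
    exact ⟨b, h3, h5, by simp, fun i => by rw [h4]; simp, by simp [h2, hmu], by simp [h1]⟩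

/-- No coordinate of the model vector is 1, so the scalar is recovered from z: pairing z = -κμ with
column j of S and using r(μᵗS)_j = -1 gives κ = r(zᵗS)_j. -/
theorem multMod_line_f_iff (hu : ¬ ∀ i, (q : ℤ) ∣ bvec a (bvec b z c) d i) {j : Fin n}
    {mu : Fin n → ℤ} (hmu : ((qf S mu / 2 : ℤ) : ZMod q) = 0)
    (hj : (r : ZMod q) * ((mu ᵥ* S) j : ℤ) = -1) (l : ℤ) :
    MultMod q (bvec a (bvec b z c) d) (CosetIndex.line S r (.f j mu l)) ↔
      (d : ZMod q) = 0 ∧ (c : ZMod q) = 0 ∧ (b : ZMod q) = 0 ∧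
        (((z ᵥ* S) j : ℤ) : ZMod q) ≠ 0 ∧
        (∀ i, (z i : ZMod q) = -(r * ((z ᵥ* S) j : ℤ)) * mu i) ∧
        (a : ZMod q) = -((z ᵥ* S) j : ℤ) * l := by
  have hx : ∀ i, (((mu + (qf S mu / 2) • (Pi.single j r : Fin n → ℤ)) i : ℤ) : ZMod q) = 1 * mu i := by
    intro i
    rw [Pi.add_apply, Pi.smul_apply, smul_eq_mul]
    push_cast
    rw [hmu]
    ring
  have hζ := vecMul_congr S hx j
  have hr : (r : ZMod q) ≠ 0 := by
    intro h
    rw [h, zero_mul] at hj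
    exact one_ne_zero (neg_eq_zero.1 hj.symm)
  rw [CosetIndex.line, multMod_bvec_iff_ne_zero hu]
  constructor
  · rintro ⟨κ, hκ, h1, h2, h3, h4, h5⟩
    have hz : ∀ i, (z i : ZMod q) = -κ * mu i := fun i => by
      rw [h3, Pi.neg_apply, Int.cast_neg, hx]
      ring
    have hzS := vecMul_congr S hz j
    have hκ' : -((r : ZMod q) * ((z ᵥ* S) j : ℤ)) = -κ := by
      rw [hzS]
      linear_combination κ * hj
    refine ⟨by simpa using h5, by simpa [hmu] using h4, ?_, ?_, fun i => by rw [hκ', hz], ?_⟩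
    · rw [h2]
      push_cast
      rw [hmu, hj]
      ring
    · intro h0
      rw [h0, mul_zero, neg_zero] at hκ'
      exact hκ (neg_eq_zero.1 hκ'.symm)
    · rw [h1, Int.cast_mul, hζ, hzS]
      ring
  · rintro ⟨h1, h2, h3, h4, h5, h6⟩
    refine ⟨r * ((z ᵥ* S) j : ℤ), mul_ne_zero hr h4, ?_, ?_, fun i => ?_, ?_, ?_⟩
    · rw [h6, Int.cast_mul, hζ]
      linear_combination (-(((z ᵥ* S) j : ℤ) : ZMod q) * l) * hj
    · rw [h3]
      push_cast
      rw [hmu, hj]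
      ring
    · rw [h5, Pi.neg_apply, Int.cast_neg, hx]
      ring
    · rw [h2, hmu, mul_zero]
    · rw [h1, Int.cast_zero, mul_zero]

theorem existsUnique_multMod_line (hS : Sᵀ = S) (hE : IsEvenForm S) (hqS : ¬ (q : ℤ) ∣ S.det)
    (hr : ¬ (q : ℤ) ∣ r) {A : Set (I0 n → ℤ)} (hA : IsResidueSystem q A)
    {N : Set (Fin n → ℤ)} (hN : IsResidueSystem q N) {L : Set ℤ} (hL : IsResidueSystem q L)
    (hiso : a * d + b * c = qf S z / 2) (hu : ¬ ∀ i, (q : ℤ) ∣ bvec a (bvec b z c) d i) :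
    ∃! i : CosetIndex n, i.Admissible S q r A N L ∧
      MultMod q (bvec a (bvec b z c) d) (i.line S r) := by
  have hr' : (r : ZMod q) ≠ 0 := by rwa [Ne, ZMod.intCast_zmod_eq_zero_iff_dvd]
  have adm_e : ∀ mu l, (CosetIndex.e mu l).Admissible S q r A N L ↔ mu ∈ N ∧ l ∈ L ∧
      (¬ ∀ i, (mu i : ZMod q) = 0) ∧ ((qf S mu / 2 : ℤ) : ZMod q) = 0 := by
    intro mu l
    simp only [CosetIndex.Admissible, ← ZMod.intCast_eq_intCast_iff, Int.cast_zero]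
  have adm_f : ∀ j mu l, (CosetIndex.f j mu l).Admissible S q r A N L ↔ mu ∈ N ∧ l ∈ L ∧
      (∀ i, j < i → (((mu ᵥ* S) i : ℤ) : ZMod q) = 0) ∧
      (r : ZMod q) * ((mu ᵥ* S) j : ℤ) = -1 ∧ ((qf S mu / 2 : ℤ) : ZMod q) = 0 := by
    intro j mu l
    simp only [CosetIndex.Admissible, ← ZMod.intCast_eq_intCast_iff, Int.cast_zero, Int.cast_mul,
      Int.cast_neg, Int.cast_one]
  have isoF : (a : ZMod q) * d + b * c = ((qf S z / 2 : ℤ) : ZMod q) := by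
    rw [← hiso]
    push_cast
    rfl
  by_cases hd : (d : ZMod q) = 0
  · by_cases hc : (c : ZMod q) = 0
    · rw [hd, hc, mul_zero, mul_zero, add_zero] at isoF
      by_cases hb : (b : ZMod q) = 0
      · by_cases hz : ∀ i, (z i : ZMod q) = 0
        · refine ⟨.b, ⟨trivial, multMod_line_b_iff.2 ⟨hd, hc, hb, hz⟩⟩, ?_⟩
          rintro (lam | _ | ⟨nu, l⟩ | l | ⟨mu, l⟩ | ⟨j, mu, l⟩) ⟨hadm, hm⟩
          · exact absurd hd ((multMod_line_a_iff hS hE hiso hu _).1 hm).1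
          · rfl
          · exact absurd hc ((multMod_line_c_iff hS hE hiso hu _ _).1 hm).2.1
          · exact absurd hb ((multMod_line_d_iff hu _).1 hm).2.2.1
          · exact absurd hb ((multMod_line_e_iff hu ((adm_e _ _).1 hadm).2.2.2 _).1 hm).2.2.1
          · obtain ⟨-, -, -, h1, h2⟩ := (adm_f _ _ _).1 hadm
            refine absurd ?_ ((multMod_line_f_iff hu h2 h1 _).1 hm).2.2.2.1
            simpa using vecMul_congr S (x := z) (y := 0) (κ := (0 : ZMod q)) (by simpa using hz) j
        · have hzS : ∃ j, (((z ᵥ* S) j : ℤ) : ZMod q) ≠ 0 := by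
            by_contra! h
            exact hz (cast_eq_zero_of_vecMul hqS h)
          obtain ⟨j, hj, hmax⟩ : ∃ j, (((z ᵥ* S) j : ℤ) : ZMod q) ≠ 0 ∧
              -- The last index is required because family f prescribes zeros of μᵗS beyond j.
              ∀ i, j < i → (((z ᵥ* S) i : ℤ) : ZMod q) = 0 := by
            obtain ⟨j₀, hj₀⟩ := hzS
            obtain ⟨j, hj⟩ := (Set.toFinite
              {j | (((z ᵥ* S) j : ℤ) : ZMod q) ≠ 0}).exists_maximal ⟨j₀, hj₀⟩
            refine ⟨j, hj.1, fun i hi => ?_⟩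
            by_contra h
            exact absurd (hj.2 h hi.le) (not_le.2 hi)
          have hs : -((r : ZMod q) * ((z ᵥ* S) j : ℤ)) ≠ 0 := neg_ne_zero.2 (mul_ne_zero hr' hj)
          -- Dividing z by -r(zᵗS)_j normalises μ so that r(μᵗS)_j = -1.
          obtain ⟨mu, hmuN, hmu, hmu'⟩ := hN.exists_pi fun i =>
            (-((r : ZMod q) * ((z ᵥ* S) j : ℤ)))⁻¹ * z i
          obtain ⟨l, hlL, hl, hl'⟩ := hL.exists_int ((-((z ᵥ* S) j : ℤ) : ZMod q)⁻¹ * a)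
          have hmuQ : ((qf S mu / 2 : ℤ) : ZMod q) = 0 := by
            rw [half_qf_congr hS hE.two_mul_half hmu, ← isoF, mul_zero]
          have hmuS := vecMul_congr S hmu
          have hmuj : (r : ZMod q) * ((mu ᵥ* S) j : ℤ) = -1 := by
            rw [hmuS]
            field_simp
          refine ⟨.f j mu l, ⟨(adm_f _ _ _).2 ⟨hmuN, hlL, fun i hi => ?_, hmuj, hmuQ⟩,
            (multMod_line_f_iff hu hmuQ hmuj l).2 ⟨hd, hc, hb, hj, fun i => ?_, ?_⟩⟩, ?_⟩
          · rw [hmuS, hmax i hi, mul_zero]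
          · rw [hmu, mul_inv_cancel_left₀ hs]
          · rw [hl, mul_inv_cancel_left₀ (neg_ne_zero.2 hj)]
          rintro (lam | _ | ⟨nu, l'⟩ | l' | ⟨mu', l'⟩ | ⟨j', mu', l'⟩) ⟨hadm, hm⟩
          · exact absurd hd ((multMod_line_a_iff hS hE hiso hu _).1 hm).1
          · exact absurd (multMod_line_b_iff.1 hm).2.2.2 hz
          · exact absurd hc ((multMod_line_c_iff hS hE hiso hu _ _).1 hm).2.1
          · exact absurd hb ((multMod_line_d_iff hu _).1 hm).2.2.1
          · exact absurd hb ((multMod_line_e_iff hu ((adm_e _ _).1 hadm).2.2.2 _).1 hm).2.2.1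
          · obtain ⟨hmuN', hlL', hmax', h1, h2⟩ := (adm_f _ _ _).1 hadm
            obtain ⟨-, -, -, k1, k2, k3⟩ := (multMod_line_f_iff hu h2 h1 _).1 hm
            -- Both indices mark the last nonzero entry of zᵗS, since z is a nonzero multiple of
            -- either μ.
            have hjj : j' = j := by
              rcases lt_trichotomy j' j with h | h | h
              · refine absurd ?_ hj
                rw [vecMul_congr S k2 j, hmax' j h, mul_zero]
              · exact h
              · exact absurd (hmax j' h) k1
            subst hjj
            rw [hmu' mu' hmuN' fun i => by rw [k2, inv_mul_cancel_left₀ hs],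
              hl' l' hlL' (by rw [k3, inv_mul_cancel_left₀ (neg_ne_zero.2 hj)])]
      · obtain ⟨l, hlL, hl, hl'⟩ := hL.exists_int ((b : ZMod q)⁻¹ * a)
        have hla : (a : ZMod q) = b * l := by rw [hl, mul_inv_cancel_left₀ hb]
        have hlu : ∀ l' ∈ L, (a : ZMod q) = b * l' → l' = l := fun l' hl'L h =>
          hl' l' hl'L (by rw [h, inv_mul_cancel_left₀ hb])
        by_cases hz : ∀ i, (z i : ZMod q) = 0
        · refine ⟨.d l, ⟨hlL, (multMod_line_d_iff hu l).2 ⟨hd, hc, hb, hz, hla⟩⟩, ?_⟩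
          rintro (lam | _ | ⟨nu, l'⟩ | l' | ⟨mu, l'⟩ | ⟨j, mu, l'⟩) ⟨hadm, hm⟩
          · exact absurd hd ((multMod_line_a_iff hS hE hiso hu _).1 hm).1
          · exact absurd (multMod_line_b_iff.1 hm).2.2.1 hb
          · exact absurd hc ((multMod_line_c_iff hS hE hiso hu _ _).1 hm).2.1
          · rw [hlu l' hadm ((multMod_line_d_iff hu _).1 hm).2.2.2.2]
          · obtain ⟨-, -, h1, h2⟩ := (adm_e _ _).1 hadm
            have h3 := ((multMod_line_e_iff hu h2 _).1 hm).2.2.2.1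
            refine absurd (fun i => ?_) h1
            have := h3 i
            rw [hz i] at this
            simpa [hb] using this
          · obtain ⟨-, -, -, h1, h2⟩ := (adm_f _ _ _).1 hadm
            exact absurd ((multMod_line_f_iff hu h2 h1 _).1 hm).2.2.1 hb
        · obtain ⟨mu, hmuN, hmu, hmu'⟩ := hN.exists_pi fun i => (-(b : ZMod q))⁻¹ * z i
          have hb' := neg_ne_zero.2 hb
          have hmuQ : ((qf S mu / 2 : ℤ) : ZMod q) = 0 := by
            rw [half_qf_congr hS hE.two_mul_half hmu, ← isoF, mul_zero]
          refine ⟨.e mu l, ⟨(adm_e _ _).2 ⟨hmuN, hlL, fun h => hz fun i => ?_, hmuQ⟩,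
            (multMod_line_e_iff hu hmuQ l).2 ⟨hd, hc, hb, fun i => ?_, hla⟩⟩, ?_⟩
          · have := hmu i
            rw [h i] at this
            simpa [hb] using this.symm
          · rw [hmu, mul_inv_cancel_left₀ hb']
          rintro (lam | _ | ⟨nu, l'⟩ | l' | ⟨mu', l'⟩ | ⟨j, mu', l'⟩) ⟨hadm, hm⟩
          · exact absurd hd ((multMod_line_a_iff hS hE hiso hu _).1 hm).1
          · exact absurd (multMod_line_b_iff.1 hm).2.2.1 hb
          · exact absurd hc ((multMod_line_c_iff hS hE hiso hu _ _).1 hm).2.1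
          · exact absurd ((multMod_line_d_iff hu _).1 hm).2.2.2.1 hz
          · obtain ⟨hmuN', hlL', -, h2⟩ := (adm_e _ _).1 hadm
            obtain ⟨-, -, -, h3, h4⟩ := (multMod_line_e_iff hu h2 _).1 hm
            rw [hlu l' hlL' h4, hmu' mu' hmuN' fun i => by rw [h3, inv_mul_cancel_left₀ hb']]
          · obtain ⟨-, -, -, h1, h2⟩ := (adm_f _ _ _).1 hadm
            exact absurd ((multMod_line_f_iff hu h2 h1 _).1 hm).2.2.1 hb
    · obtain ⟨l, hlL, hl, hl'⟩ := hL.exists_int ((c : ZMod q)⁻¹ * a)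
      obtain ⟨nu, hnuN, hnu, hnu'⟩ := hN.exists_pi fun i => (-(c : ZMod q))⁻¹ * z i
      have hc' := neg_ne_zero.2 hc
      refine ⟨.c nu l, ⟨⟨hnuN, hlL⟩, (multMod_line_c_iff hS hE hiso hu nu l).2
        ⟨hd, hc, fun i => ?_, ?_⟩⟩, ?_⟩
      · rw [hnu, mul_inv_cancel_left₀ hc']
      · rw [hl, mul_inv_cancel_left₀ hc]
      rintro (lam | _ | ⟨nu', l'⟩ | l' | ⟨mu, l'⟩ | ⟨j, mu, l'⟩) ⟨hadm, hm⟩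
      · exact absurd hd ((multMod_line_a_iff hS hE hiso hu _).1 hm).1
      · exact absurd (multMod_line_b_iff.1 hm).2.1 hc
      · obtain ⟨-, -, h3, h4⟩ := (multMod_line_c_iff hS hE hiso hu _ _).1 hm
        rw [hl' l' hadm.2 (by rw [h4, inv_mul_cancel_left₀ hc]),
          hnu' nu' hadm.1 fun i => by rw [h3, inv_mul_cancel_left₀ hc']]
      · exact absurd ((multMod_line_d_iff hu _).1 hm).2.1 hc
      · exact absurd ((multMod_line_e_iff hu ((adm_e _ _).1 hadm).2.2.2 _).1 hm).2.1 hc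
      · obtain ⟨-, -, -, h1, h2⟩ := (adm_f _ _ _).1 hadm
        exact absurd ((multMod_line_f_iff hu h2 h1 _).1 hm).2.1 hc
  · obtain ⟨lam, hlamA, hlam, hlam'⟩ := hA.exists_pi fun i =>
      (-(d : ZMod q))⁻¹ * (bvec b z c i : ℤ)
    have hd' := neg_ne_zero.2 hd
    refine ⟨.a lam, ⟨hlamA, (multMod_line_a_iff hS hE hiso hu lam).2 ⟨hd, fun i => ?_⟩⟩, ?_⟩
    · rw [hlam, mul_inv_cancel_left₀ hd']
    rintro (lam' | _ | ⟨nu', l'⟩ | l' | ⟨mu, l'⟩ | ⟨j, mu, l'⟩) ⟨hadm, hm⟩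
    · obtain ⟨-, h2⟩ := (multMod_line_a_iff hS hE hiso hu _).1 hm
      rw [hlam' lam' hadm fun i => by rw [h2, inv_mul_cancel_left₀ hd']]
    · exact absurd (multMod_line_b_iff.1 hm).1 hd
    · exact absurd ((multMod_line_c_iff hS hE hiso hu _ _).1 hm).1 hd
    · exact absurd ((multMod_line_d_iff hu _).1 hm).1 hd
    · exact absurd ((multMod_line_e_iff hu ((adm_e _ _).1 hadm).2.2.2 _).1 hm).1 hd
    · obtain ⟨-, -, -, h1, h2⟩ := (adm_f _ _ _).1 hadm
      exact absurd ((multMod_line_f_iff hu h2 h1 _).1 hm).1 hd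

end Classification

theorem lemma7 {n : ℕ} (S : Matrix (Fin n) (Fin n) ℤ) (hS : PosDefMaxEven S)
    (q : ℕ) (hq : q.Prime) (hqS : ¬ (q : ℤ) ∣ S.det) (r : ℤ) (hr : ¬ (q : ℤ) ∣ r)
    (A : Set (I0 n → ℤ)) (hA : IsResidueSystem q A)
    (N : Set (Fin n → ℤ)) (hN : IsResidueSystem q N)
    (L : Set ℤ) (hL : IsResidueSystem q L) :
    (∀ i : CosetIndex n, i.Admissible S q r A N L → i.rep S q r ∈ heckeT S q) ∧
      ∀ R ∈ heckeT S q, ∃! i : CosetIndex n,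
        i.Admissible S q r A N L ∧ ∃ γ ∈ GammaS S, R = γ * i.rep S q r := by
  have hE := hS.isEvenForm
  have hline := hasLine_rep hS.posDef hE q r
  refine ⟨fun i _ => (hline i).mem_heckeT, fun R hR => ?_⟩
  have : Fact q.Prime := ⟨hq⟩
  have hq' : Prime (q : ℤ) := Nat.prime_iff_prime_int.1 hq
  have hq0 : (0 : ℤ) < q := by exact_mod_cast hq.pos
  obtain ⟨u, hu⟩ := exists_hasLine hR
  -- From here on only the line of R matters.
  simp only [hu.coset_iff hE hq' hq0 hqS (hline _)]
  have hiso := hu.qf_eq_zero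
  have hne := hu.not_dvd hq'
  obtain ⟨a, b, z, c, d, rfl⟩ := exists_bvec_bvec u
  refine existsUnique_multMod_line (symm_of_posDef hS.posDef) hE hqS hr hA hN hL ?_ hne
  have h := hE.two_mul_half z
  rw [S1, qf_addHyp, qf_S0] at hiso
  linarith
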